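/- **Proposition 2.1.** Let $G$ be a (finite-dimensional, real) Lie group, $H$ a closed Lie subgroup, and give $G/H$ its usual smooth structure, the one for which $\pi\colon G\to G/H$ is a submersion. Suppose that $\mathfrak g=\mathfrak h\oplus\mathfrak m$ is a reductive decomposition, i.e. $\mathfrak m$ is an $\mathrm{Ad}(H)$-invariant vector space complement of $\mathfrak h$. Write $[X,Y]_{\mathfrak m}$ for the $\mathfrak m$-component of $[X,Y]$, and identify $\mathfrak m\cong T_{eH}(G/H)$ via $\mathrm d\pi_e$. Let $\langle\cdot,\cdot\rangle$ be a $G$-invariant Riemannian metric on $G/H$ with Levi-Civita connection $\nabla$, and let $\alpha(X,Y)=(\nabla_{X^{\#}}Y^{\#})|_{eH}+[X,Y]_{\mathfrak m}$ for $X,Y\in\mathfrak m$ be its Levi-Civita product, where $X^{\#}$ is the action field of $X$, whose flow is $(t,aH)\mapsto \exp(tX)aH$. A smooth symmetric twice-covariant tensor field $A$ on $G/H$ is called *Codazzi* if $(\nabla_{\boldsymbol X}A)(\boldsymbol Y,\boldsymbol Z)=(\nabla_{\boldsymbol Y}A)(\boldsymbol X,\boldsymbol Z)$ for all smooth vector fields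 $\boldsymbol X,\boldsymbol Y,\boldsymbol Z$. The value at $eH$ of a $G$-invariant $A$ is regarded as a symmetric bilinear form on $\mathfrak m$. (1) Let $A$ be a $G$-invariant Codazzi tensor field, let $\lambda_1<\dots<\lambda_r$ be the distinct eigenvalues of $A$ on $\mathfrak m$ with respect to $\langle\cdot,\cdot\rangle$ (so $r=0$ if $\mathfrak m=0$), and let $\mathfrak m_i=\{X\in\mathfrak m : A(X,Y)=\lambda_i\langle X,Y\rangle \text{ for all } Y\in\mathfrak m\}$, so that $\mathfrak m=\mathfrak m_1\oplus\dots\oplus\mathfrak m_r$ is an orthogonal direct sum. Then each $\mathfrak m_i$ is $\mathrm{Ad}(H)$-invariant, is closed under $[\cdot,\cdot]_{\mathfrak m}$, and is closed under $\alpha$; and $$(\lambda_i-\lambda_k)^2\langle [X_i,Y_j]_{\mathfrak m},Z_k\rangle+(\lambda_j-\lambda_i)^2\langle [X_i,Z_k]_{\mathfrak m},Y_j\rangle=0\qquad(\ast)$$ for all $i,j,k\in\{1,\dots,r\}$ and all $X_i\in\mathfrak m_i$, $Y_j\in\mathfrak m_j$, $Z_k\in\mathfrak m_k$. (2) Conversely,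 let $\mathfrak m=\mathfrak m_1\oplus\dots\oplus\mathfrak m_r$ be a direct sum decomposition into mutually orthogonal $\mathrm{Ad}(H)$-invariant subspaces, and let $\lambda_1,\dots,\lambda_r$ be mutually distinct real numbers such that $(\ast)$ holds. Then there is exactly one $G$-invariant symmetric twice-covariant tensor field $A$ on $G/H$ whose value at $eH$ is $\bigoplus_{i=1}^r\lambda_i\langle\cdot,\cdot\rangle|_{\mathfrak m_i\times\mathfrak m_i}$, and $A$ is Codazzi. (3) In both situations, $\nabla A\neq 0$ if and only if there are mutually distinct $i,j,k$ and $X_i\in\mathfrak m_i$, $Y_j\in\mathfrak m_j$, $Z_k\in\mathfrak m_k$ with $\langle X_i,[Y_j,Z_k]_{\mathfrak m}\rangle\neq 0$; in that case $A$ has at least three distinct eigenvalues. -/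

import Mathlib

open Set Bundle Manifold
open scoped ContDiff Topology

noncomputable section

section Tensors

variable {B : Type*} [NormedAddCommGroup B] [NormedSpace ℝ B] [FiniteDimensional ℝ B]
  {M : Type*} [TopologicalSpace M] [ChartedSpace B M] [IsManifold 𝓘(ℝ, B) ∞ M]

variable (B M) in
/-- A smooth symmetric twice-covariant tensor field on the manifold `M` modelled on `B`. -/
structure SymmTensorField where
  /-- the bilinear form on each tangent space -/
  form (p : M) : TangentSpace 𝓘(ℝ, B) p →L[ℝ] TangentSpace 𝓘(ℝ, B) p →L[ℝ] ℝ
  symm (p : M) (u v : TangentSpace 𝓘(ℝ, B) p) : form p u v = form p v u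
  contMDiff : ContMDiff 𝓘(ℝ, B) (𝓘(ℝ, B).prod 𝓘(ℝ, B →L[ℝ] B →L[ℝ] ℝ)) ∞
    (fun p ↦ TotalSpace.mk' (B →L[ℝ] B →L[ℝ] ℝ)
      (E := fun p : M ↦ TangentSpace 𝓘(ℝ, B) p →L[ℝ] TangentSpace 𝓘(ℝ, B) p →L[ℝ] ℝ) p (form p))

variable (B M) in
/-- An affine connection on `M`. Mathlib writes `D Y p v` for `(∇_v Y)(p)`, `v ∈ T_p M`. -/
abbrev AffineConnection :=
  CovariantDerivative 𝓘(ℝ, B) B (fun p : M ↦ TangentSpace 𝓘(ℝ, B) p)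

variable (B M) in
/-- A smooth vector field on `M`. -/
abbrev SmoothVectorField :=
  ContMDiffSection 𝓘(ℝ, B) B ∞ (fun p : M ↦ TangentSpace 𝓘(ℝ, B) p)

variable (B M) in
/-- A smooth Riemannian metric on `M`; `g.inner p u v` is the inner product of `u, v ∈ T_p M`. -/
abbrev SmoothMetric :=
  ContMDiffRiemannianMetric 𝓘(ℝ, B) ∞ B (fun p : M ↦ TangentSpace 𝓘(ℝ, B) p)

/-- `D` is the Levi-Civita connection of the Riemannian metric `g`: it is torsion-free and
compatible with `g`, that is, `v(g(Y, Z)) = g(∇_v Y, Z) + g(Y, ∇_v Z)`. -/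
def AffineConnection.IsLeviCivita (D : AffineConnection B M) (g : SmoothMetric B M) : Prop :=
  haveI : CompleteSpace B := FiniteDimensional.complete ℝ B
  CovariantDerivative.torsion D = 0 ∧
    ∀ (Y Z : Π p : M, TangentSpace 𝓘(ℝ, B) p) (p : M),
      MDiffAt (T% Y) p → MDiffAt (T% Z) p → ∀ v : TangentSpace 𝓘(ℝ, B) p,
        mvfderiv 𝓘(ℝ, B) (fun q : M ↦ g.inner q (Y q) (Z q)) p v
          = g.inner p (D Y p v) (Z p) + g.inner p (Y p) (D Z p v)

namespace SymmTensorField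

/-- The value `(∇_X A)(Y, Z) = X(A(Y, Z)) - A(∇_X Y, Z) - A(Y, ∇_X Z)` at the point `p`. -/
def covDeriv (A : SymmTensorField B M) (D : AffineConnection B M)
    (X Y Z : SmoothVectorField B M) (p : M) : ℝ :=
  mvfderiv 𝓘(ℝ, B) (fun q : M ↦ A.form q (Y q) (Z q)) p (X p)
    - A.form p (D Y p (X p)) (Z p) - A.form p (Y p) (D Z p (X p))

/-- The Codazzi equation `(∇_X A)(Y, Z) = (∇_Y A)(X, Z)` for a torsion-free connection. -/
def IsCodazzi (A : SymmTensorField B M) (D : AffineConnection B M) : Prop :=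
  ∀ (X Y Z : SmoothVectorField B M) (p : M), A.covDeriv D X Y Z p = A.covDeriv D Y X Z p

/-- The equation `∇A = 0`. -/
def IsParallel (A : SymmTensorField B M) (D : AffineConnection B M) : Prop :=
  ∀ (X Y Z : SmoothVectorField B M) (p : M), A.covDeriv D X Y Z p = 0

end SymmTensorField

end Tensors

section Homogeneous

variable {E : Type*} [NormedAddCommGroup E] [NormedSpace ℝ E] [FiniteDimensional ℝ E]
  {F : Type*} [NormedAddCommGroup F] [NormedSpace ℝ F] [FiniteDimensional ℝ F]
  {B : Type*} [NormedAddCommGroup B] [NormedSpace ℝ B] [FiniteDimensional ℝ B]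
  {G : Type*} [Group G] [TopologicalSpace G] [ChartedSpace E G]

variable (E) in
/-- The adjoint action `Ad(a)` on the Lie algebra of `G`: the derivative at `1` of `x ↦ a x a⁻¹`. -/
def adjointAction (a : G) : GroupLieAlgebra 𝓘(ℝ, E) G →L[ℝ] GroupLieAlgebra 𝓘(ℝ, E) G :=
  mfderiv 𝓘(ℝ, E) 𝓘(ℝ, E) (fun x : G ↦ a * x * a⁻¹) 1

variable (E F) in
/-- The Lie algebra of the Lie subgroup `H`, inside the Lie algebra of `G`: the image of the
tangent space of `H` at `1` under the derivative of the inclusion. -/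
def subgroupLieAlgebra (H : Subgroup G) [ChartedSpace F H] :
    Submodule ℝ (GroupLieAlgebra 𝓘(ℝ, E) G) :=
  LinearMap.range
    (mfderiv 𝓘(ℝ, F) 𝓘(ℝ, E) (Subtype.val : H → G) 1 : F →L[ℝ] E).toLinearMap

variable (E F) in
/-- A reductive decomposition `𝔤 = 𝔥 ⊕ 𝔪`: an `Ad(H)`-invariant vector space complement `𝔪` of the
Lie algebra `𝔥` of `H`. -/
structure ReductiveDecomposition (H : Subgroup G) [ChartedSpace F H] where
  /-- the reductive complement `𝔪` -/
  compl : Submodule ℝ (GroupLieAlgebra 𝓘(ℝ, E) G)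
  isCompl : IsCompl (subgroupLieAlgebra E F H) compl
  ad_mem : ∀ h ∈ H, ∀ X ∈ compl, adjointAction E h X ∈ compl

variable {H : Subgroup G}

section Quotient

variable [ChartedSpace B (G ⧸ H)]

variable (H) in
/-- The base point `eH` of `G/H`. -/
abbrev basePoint : G ⧸ H := ((1 : G) : G ⧸ H)

variable (E B H) in
/-- The derivative at `1` of the projection `G → G/H`. -/
def projDeriv : GroupLieAlgebra 𝓘(ℝ, E) G →L[ℝ] TangentSpace 𝓘(ℝ, B) (basePoint H) :=
  mfderiv 𝓘(ℝ, E) 𝓘(ℝ, B) (fun a : G ↦ (a : G ⧸ H)) 1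

variable (B H) in
/-- The derivative at `p` of the left translation of `G/H` by `a`. -/
def translationDeriv (a : G) (p : G ⧸ H) :
    TangentSpace 𝓘(ℝ, B) p →L[ℝ] TangentSpace 𝓘(ℝ, B) (a • p) :=
  mfderiv 𝓘(ℝ, B) 𝓘(ℝ, B) (fun q : G ⧸ H ↦ a • q) p

variable (B H) in
/-- The action field `X^#` on `G/H` of an element `X` of the Lie algebra of `G`, that is, the
velocity of the flow `(t, p) ↦ exp(tX) • p`. Its value at `p` is the image of `X` under the
derivative at `1` of the orbit map `a ↦ a • p`. -/
def actionField (X : GroupLieAlgebra 𝓘(ℝ, E) G) (p : G ⧸ H) : TangentSpace 𝓘(ℝ, B) p :=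
  (mfderiv 𝓘(ℝ, E) 𝓘(ℝ, B) (fun a : G ↦ a • p) 1 : E →L[ℝ] B) X

/-- `G`-invariance of a symmetric twice-covariant tensor field on `G/H`. -/
def SymmTensorField.IsInvariant [IsManifold 𝓘(ℝ, B) ∞ (G ⧸ H)]
    (A : SymmTensorField B (G ⧸ H)) : Prop :=
  ∀ (a : G) (p : G ⧸ H) (u v : TangentSpace 𝓘(ℝ, B) p),
    A.form (a • p) (translationDeriv B H a p u) (translationDeriv B H a p v) = A.form p u v

/-- `G`-invariance of a Riemannian metric on `G/H`. -/
def SmoothMetric.IsInvariant [IsManifold 𝓘(ℝ, B) ∞ (G ⧸ H)] (g : SmoothMetric B (G ⧸ H)) : Prop :=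
  ∀ (a : G) (p : G ⧸ H) (u v : TangentSpace 𝓘(ℝ, B) p),
    g.inner (a • p) (translationDeriv B H a p u) (translationDeriv B H a p v) = g.inner p u v

variable (E) in
/-- The bilinear form on the Lie algebra of `G` obtained from `A` at `eH` through the derivative of
the projection; on `𝔪` it is the tensor which corresponds to `A`. -/
def SymmTensorField.atBase [IsManifold 𝓘(ℝ, B) ∞ (G ⧸ H)] (A : SymmTensorField B (G ⧸ H))
    (X Y : GroupLieAlgebra 𝓘(ℝ, E) G) : ℝ :=
  A.form (basePoint H) (projDeriv E B H X) (projDeriv E B H Y)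

variable (E) in
/-- The bilinear form `⟨X, Y⟩` on the Lie algebra of `G` obtained from the metric at `eH` through
the derivative of the projection; on `𝔪` it is the inner product which corresponds to the metric. -/
def SmoothMetric.atBase [IsManifold 𝓘(ℝ, B) ∞ (G ⧸ H)] (g : SmoothMetric B (G ⧸ H))
    (X Y : GroupLieAlgebra 𝓘(ℝ, E) G) : ℝ :=
  g.inner (basePoint H) (projDeriv E B H X) (projDeriv E B H Y)

end Quotient

namespace ReductiveDecomposition

variable [ChartedSpace F H] (P : ReductiveDecomposition E F H)

/-- The product `[X, Y]_𝔪`: the component in `𝔪` of the Lie bracket, along `𝔥`. -/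
def bracket (X Y : GroupLieAlgebra 𝓘(ℝ, E) G) : GroupLieAlgebra 𝓘(ℝ, E) G :=
  P.compl.projection (subgroupLieAlgebra E F H) P.isCompl.symm ⁅X, Y⁆

/-- `V` is an `Ad(H)`-invariant subspace. -/
def AdInvariant (_P : ReductiveDecomposition E F H)
    (V : Submodule ℝ (GroupLieAlgebra 𝓘(ℝ, E) G)) : Prop :=
  ∀ h ∈ H, ∀ X ∈ V, adjointAction E h X ∈ V

/-- `V` is closed under the product `[X, Y]_𝔪`. -/
def IsSubalgebra (V : Submodule ℝ (GroupLieAlgebra 𝓘(ℝ, E) G)) : Prop :=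
  ∀ X ∈ V, ∀ Y ∈ V, P.bracket X Y ∈ V

variable [ChartedSpace B (G ⧸ H)] [IsManifold 𝓘(ℝ, B) ∞ (G ⧸ H)]

/-- The product `α(X, Y) = (∇_{X^#} Y^#)(eH) + [X, Y]_𝔪` of `X, Y ∈ 𝔪`, as an element of the tangent
space at `eH`, which is identified with `𝔪` through the derivative of the projection. -/
def product (D : AffineConnection B (G ⧸ H)) (X Y : GroupLieAlgebra 𝓘(ℝ, E) G) :
    TangentSpace 𝓘(ℝ, B) (basePoint H) :=
  D (actionField B H Y) (basePoint H) (actionField B H X (basePoint H))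
    + projDeriv E B H (P.bracket X Y)

/-- `V` is closed under the product `α`. -/
def IsClosedUnderProduct (D : AffineConnection B (G ⧸ H))
    (V : Submodule ℝ (GroupLieAlgebra 𝓘(ℝ, E) G)) : Prop :=
  ∀ X ∈ V, ∀ Y ∈ V, ∃ W ∈ V, projDeriv E B H W = P.product D X Y

/-- The subspace of those `X ∈ 𝔪` with `A(X, Y) = c ⟨X, Y⟩` for all `Y ∈ 𝔪`. It is the eigenspace
of `A`, with respect to `g`, for `c` when it is not zero. -/
def eigenspace (g : SmoothMetric B (G ⧸ H)) (A : SymmTensorField B (G ⧸ H)) (c : ℝ) :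
    Submodule ℝ (GroupLieAlgebra 𝓘(ℝ, E) G) where
  carrier := {X | X ∈ P.compl ∧ ∀ Y ∈ P.compl, A.atBase E X Y = c * g.atBase E X Y}
  zero_mem' := ⟨P.compl.zero_mem, fun Y _ ↦ by
    simp [SymmTensorField.atBase, SmoothMetric.atBase]⟩
  add_mem' {X X'} hX hX' := ⟨P.compl.add_mem hX.1 hX'.1, fun Y hY ↦ by
    have h1 := hX.2 Y hY
    have h2 := hX'.2 Y hY
    simp only [SymmTensorField.atBase, SmoothMetric.atBase, map_add, add_apply] at h1 h2 ⊢
    rw [h1, h2]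
    ring⟩
  smul_mem' t X hX := ⟨P.compl.smul_mem t hX.1, fun Y hY ↦ by
    have h1 := hX.2 Y hY
    simp only [SymmTensorField.atBase, SmoothMetric.atBase, map_smul, smul_apply,
      smul_eq_mul] at h1 ⊢
    rw [h1]
    ring⟩

/-- `𝔪 = V 0 ⊕ ⋯ ⊕ V (r - 1)` is a direct sum of mutually orthogonal subspaces. -/
structure IsOrthogonalDecomposition (g : SmoothMetric B (G ⧸ H)) {r : ℕ}
    (V : Fin r → Submodule ℝ (GroupLieAlgebra 𝓘(ℝ, E) G)) : Prop where
  independent : iSupIndep V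
  iSup_eq : ⨆ i, V i = P.compl
  orthogonal : ∀ i j, i ≠ j → ∀ X ∈ V i, ∀ Y ∈ V j, g.atBase E X Y = 0

/-- The compatibility condition
`(λ_i - λ_k)² ⟨[X_i, Y_j]_𝔪, Z_k⟩ + (λ_j - λ_i)² ⟨[X_i, Z_k]_𝔪, Y_j⟩ = 0`. -/
def Compatible (g : SmoothMetric B (G ⧸ H)) {r : ℕ}
    (V : Fin r → Submodule ℝ (GroupLieAlgebra 𝓘(ℝ, E) G)) (lam : Fin r → ℝ) : Prop :=
  ∀ i j k, ∀ X ∈ V i, ∀ Y ∈ V j, ∀ Z ∈ V k,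
    (lam i - lam k) ^ 2 * g.atBase E (P.bracket X Y) Z
      + (lam j - lam i) ^ 2 * g.atBase E (P.bracket X Z) Y = 0

/-- There are mutually distinct `i, j, k` and `X ∈ V i`, `Y ∈ V j`, `Z ∈ V k` with
`⟨X, [Y, Z]_𝔪⟩ ≠ 0`. -/
def HasNonzeroTriple (g : SmoothMetric B (G ⧸ H)) {r : ℕ}
    (V : Fin r → Submodule ℝ (GroupLieAlgebra 𝓘(ℝ, E) G)) : Prop :=
  ∃ i j k, i ≠ j ∧ j ≠ k ∧ i ≠ k ∧
    ∃ X ∈ V i, ∃ Y ∈ V j, ∃ Z ∈ V k, g.atBase E X (P.bracket Y Z) ≠ 0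

end ReductiveDecomposition

end Homogeneous

end

/-! The computation uses the action fields X^#, whose values span every tangent space because G acts
transitively. Invariance of A under the flow of X^#, the relation [X^#, Y^#] = -[X, Y]^# and
vanishing torsion give (∇_{X^#} A)(Y^#, Z^#) = -A(∇_{Y^#} X^#, Z^#) - A(Y^#, ∇_{Z^#} X^#); this is
`covDerivAt_fundamentalField`. So everything is governed by the form Γ(X, Y, Z) = ⟨∇_{Y^#} X^#, Z^#⟩
at eH (`leviCivitaForm`). Taking the metric for A shows that Γ is skew in Y and Z, and vanishing
torsion then gives Γ(X, Y, Z) + Γ(Y, Z, X) = ⟨[X, Y], Z⟩. Moreover α(X, Y) = ∇_{Y^#} X^#, so Γ(X, Y,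
Z) = ⟨α(X, Y), Z⟩.

Let X, Y, Z be eigenvectors for λ_i, λ_j, λ_k. Then (∇_X A)(Y, Z) = (λ_j - λ_k) Γ(X, Y, Z). Write p,
q, s for Γ(X, Y, Z), Γ(Y, Z, X), Γ(Z, X, Y) and u, v, w for λ_j - λ_k, λ_k - λ_i, λ_i - λ_j, so that
u + v + w = 0. The Codazzi equation says u p = v q = w s, while (∗) says v² (p + q) = w² (s + p).
The former implies the latter, and the three cyclic instances of the latter imply the former
(`mul_eq_mul_of_sq_relations`). When i = j ≠ k the Codazzi relations force p = q = 0, which makes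
the eigenspaces closed under α and the bracket. Finally v w (q + s) = -u² p compares ⟨X, [Y, Z]⟩
with ∇A and yields the criterion for ∇A ≠ 0.

Two reductions justify working at eH. The form ∇A is tensorial, so arbitrary vector fields may be
replaced by action fields; and ∇ is equivariant because the cyclic sums of Γ, which are invariant,
determine Γ. In the converse direction, the prescribed form at eH is Ad(H)-invariant, so translating
it gives a well-defined field on G/H, smooth because the projection has smooth local sections. -/

open Set Bundle Manifold
open scoped ContDiff Topology

noncomputable section

/-! ### Linear algebra: diagonalization, triadditive functions, the quadratic relations. -/

section Algebra

/-- Simultaneous diagonalization of a symmetric form and a positive definite form. -/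
theorem exists_mem_iSup_eigenspace {W : Type*} [AddCommGroup W] [Module ℝ W]
    [FiniteDimensional ℝ W] (β γ : LinearMap.BilinForm ℝ W) (hβ : ∀ x y, β x y = β y x)
    (hγ : ∀ x y, γ x y = γ y x) (hpos : ∀ x, x ≠ 0 → 0 < γ x x) :
    ∃ T : Module.End ℝ W, (∀ x y, γ (T x) y = β x y) ∧ ⨆ c : ℝ, T.eigenspace c = ⊤ := by
  have hnd : γ.Nondegenerate := by
    refine (LinearMap.IsRefl.nondegenerate_iff_separatingLeft (fun x y h ↦ by rw [hγ, h])).2 ?_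
    intro x hx
    by_contra hne
    exact (hpos x hne).ne' (hx x)
  -- T represents β with respect to γ. It is self-adjoint for the inner product γ, so the spectral
  -- theorem applies.
  let T : Module.End ℝ W := (γ.toDual hnd).symm.toLinearMap ∘ₗ β
  have hT : ∀ x y, γ (T x) y = β x y := fun x y ↦
    LinearMap.BilinForm.apply_toDual_symm_apply (B := γ) (hB := hnd) (β x) y
  refine ⟨T, hT, ?_⟩
  let core : InnerProductSpace.Core ℝ W :=
    { inner := fun x y ↦ γ x y
      conj_inner_symm := fun x y ↦ by simpa using hγ y x
      re_inner_nonneg := fun x ↦ by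
        by_cases h : x = 0
        · simp [h]
        · simpa using (hpos x h).le
      add_left := fun x y z ↦ by simp
      smul_left := fun x y r ↦ by simp
      definite := fun x h ↦ by
        by_contra hne
        exact (hpos x hne).ne' h }
  let _ : NormedAddCommGroup W := core.toNormedAddCommGroup
  let _ : InnerProductSpace ℝ W := InnerProductSpace.ofCore core.toCore
  have hsymm : T.IsSymmetric := fun x y ↦ by
    change γ (T x) y = γ x (T y)
    rw [hT, hγ x, hT, hβ]
  exact Submodule.orthogonal_eq_bot_iff.1 hsymm.orthogonalComplement_iSup_eigenspaces_eq_bot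

/-- A triadditive function vanishes on a sum of subspaces if it vanishes on the summands. -/
theorem eq_zero_of_mem_iSup {W ι : Type*} [AddCommGroup W] [Module ℝ W] {V : ι → Submodule ℝ W}
    {φ : W → W → W → ℝ} (h₁ : ∀ x x' y z, φ (x + x') y z = φ x y z + φ x' y z)
    (h₂ : ∀ x y y' z, φ x (y + y') z = φ x y z + φ x y' z)
    (h₃ : ∀ x y z z', φ x y (z + z') = φ x y z + φ x y z')
    (h : ∀ i j k, ∀ x ∈ V i, ∀ y ∈ V j, ∀ z ∈ V k, φ x y z = 0)
    {x y z : W} (hx : x ∈ ⨆ i, V i) (hy : y ∈ ⨆ i, V i) (hz : z ∈ ⨆ i, V i) : φ x y z = 0 := by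
  have e₁ : ∀ y z, φ 0 y z = 0 := fun y z ↦ by simpa using h₁ 0 0 y z
  have e₂ : ∀ x z, φ x 0 z = 0 := fun x z ↦ by simpa using h₂ x 0 0 z
  have e₃ : ∀ x y, φ x y 0 = 0 := fun x y ↦ by simpa using h₃ x y 0 0
  induction hx using Submodule.iSup_induction' with
  | mem i x hx =>
    induction hy using Submodule.iSup_induction' with
    | mem j y hy =>
      induction hz using Submodule.iSup_induction' with
      | mem k z hz => exact h i j k x hx y hy z hz
      | zero => exact e₃ _ _
      | add z z' _ _ hz hz' => rw [h₃, hz, hz', add_zero]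
    | zero => exact e₂ _ _
    | add y y' _ _ hy hy' => rw [h₂, hy, hy', add_zero]
  | zero => exact e₁ _ _
  | add x x' _ _ hx hx' => rw [h₁, hx, hx', add_zero]

/-- If `(u p, v q, w s)` satisfies the quadratic relations for all cyclic permutations, where
`u + v + w = 0`, then `u p = v q`. -/
theorem mul_eq_mul_of_sq_relations {p q s u v w : ℝ} (h : u + v + w = 0)
    (h₁ : v ^ 2 * (p + q) - w ^ 2 * (s + p) = 0)
    (h₂ : w ^ 2 * (q + s) - u ^ 2 * (p + q) = 0)
    (h₃ : u ^ 2 * (s + p) - v ^ 2 * (q + s) = 0) : u * p = v * q := by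
  obtain rfl : w = -u - v := by linarith
  -- The sum of the first two relations factors as 2w(up - vq). If w = 0, then v = -u and the first
  -- relation alone reads u²(p + q) = 0.
  have e : (-u - v) * (u * p - v * q) = 0 := by linear_combination (h₁ + h₂) / 2
  rcases mul_eq_zero.1 e with hw | he
  · obtain rfl : v = -u := by linarith
    have e' : u ^ 2 * (p + q) = 0 := by linear_combination h₁
    rcases mul_eq_zero.1 e' with hu | ha
    · simp [pow_eq_zero_iff] at hu
      simp [hu]
    · linear_combination u * ha
  · exact sub_eq_zero.1 he

end Algebra

/-! ### Naturality of the Lie bracket under smooth maps. -/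

section RelatedFields

open VectorField

/-- Lie brackets of `f`-related vector fields on normed spaces are `f`-related. -/
theorem fderiv_lieBracket_of_related {E E' : Type*} [NormedAddCommGroup E] [NormedSpace ℝ E]
    [NormedAddCommGroup E'] [NormedSpace ℝ E'] {f : E → E'} {V W : E → E} {V' W' : E' → E'} {x : E}
    (hf : ContDiffAt ℝ 2 f x)
    (hV : DifferentiableAt ℝ V x) (hW : DifferentiableAt ℝ W x)
    (hV' : DifferentiableAt ℝ V' (f x)) (hW' : DifferentiableAt ℝ W' (f x))
    (hVV : ∀ᶠ y in 𝓝 x, fderiv ℝ f y (V y) = V' (f y))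
    (hWW : ∀ᶠ y in 𝓝 x, fderiv ℝ f y (W y) = W' (f y)) :
    fderiv ℝ f x (lieBracketWithin ℝ V W univ x) = lieBracketWithin ℝ V' W' univ (f x) := by
  have hdf : DifferentiableAt ℝ f x := hf.differentiableAt (by norm_num)
  have hddf : DifferentiableAt ℝ (fderiv ℝ f) x :=
    (hf.fderiv_right (m := 1) (by norm_num)).differentiableAt (by norm_num)
  -- Differentiate the relation df(U) = U' ∘ f along v. In the difference of the two instances the
  -- second derivatives of f cancel by symmetry.
  have key : ∀ (U : E → E) (U' : E' → E'), DifferentiableAt ℝ U x → DifferentiableAt ℝ U' (f x) →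
      (∀ᶠ y in 𝓝 x, fderiv ℝ f y (U y) = U' (f y)) → ∀ v,
      fderiv ℝ U' (f x) (fderiv ℝ f x v)
        = fderiv ℝ (fderiv ℝ f) x v (U x) + fderiv ℝ f x (fderiv ℝ U x v) := by
    intro U U' hU hU' h v
    have h1 : HasFDerivAt (fun y ↦ fderiv ℝ f y (U y)) _ x :=
      hddf.hasFDerivAt.clm_apply hU.hasFDerivAt
    have h2 : HasFDerivAt (fun y ↦ U' (f y)) _ x := hU'.hasFDerivAt.comp x hdf.hasFDerivAt
    have h3 := (h2.congr_of_eventuallyEq h).unique h1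
    have h4 := congrArg (fun L : E →L[ℝ] E' ↦ L v) h3
    simpa [add_comm] using h4
  have hs : fderiv ℝ (fderiv ℝ f) x (V x) (W x) = fderiv ℝ (fderiv ℝ f) x (W x) (V x) :=
    (hf.isSymmSndFDerivAt (by simp)) _ _
  simp only [lieBracketWithin_univ, lieBracket, map_sub]
  rw [← hVV.self_of_nhds, ← hWW.self_of_nhds, key V V' hV hV' hVV, key W W' hW hW' hWW, hs]
  abel

variable {E E' H H' : Type*} [NormedAddCommGroup E] [NormedSpace ℝ E] [CompleteSpace E]
  [NormedAddCommGroup E'] [NormedSpace ℝ E'] [CompleteSpace E']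
  [TopologicalSpace H] [TopologicalSpace H']
  {I : ModelWithCorners ℝ E H} {I' : ModelWithCorners ℝ E' H'} [I.Boundaryless] [I'.Boundaryless]
  {M M' : Type*} [TopologicalSpace M] [ChartedSpace H M] [IsManifold I 2 M]
  [TopologicalSpace M'] [ChartedSpace H' M'] [IsManifold I' 2 M']

/-- Lie brackets of `f`-related vector fields on manifolds are `f`-related. -/
theorem mfderiv_mlieBracket_of_related {f : M → M'} {x : M}
    {V W : Π y : M, TangentSpace I y} {V' W' : Π y : M', TangentSpace I' y}
    (hf : ContMDiffAt I I' 2 f x)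
    (hV : MDiffAt (T% V) x) (hW : MDiffAt (T% W) x)
    (hV' : MDiffAt (T% V') (f x)) (hW' : MDiffAt (T% W') (f x))
    (hVV : ∀ᶠ y in 𝓝 x, mfderiv I I' f y (V y) = V' (f y))
    (hWW : ∀ᶠ y in 𝓝 x, mfderiv I I' f y (W y) = W' (f y)) :
    mfderiv I I' f x (mlieBracket I V W x) = mlieBracket I' V' W' (f x) := by
  -- The bracket at a point is computed in the preferred chart there, so it suffices to show that
  -- the fields read in these two charts are related by the local expression F of f.
  set φ := extChartAt I x with hφ
  set ψ := extChartAt I' (f x) with hψ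
  set F : E → E' := ψ ∘ f ∘ φ.symm with hF
  have hxφ : φ.symm (φ x) = x := extChartAt_to_inv x
  have hFx : F (φ x) = ψ (f x) := by simp [hF, hxφ]
  have hFc : ContDiffAt ℝ 2 F (φ x) := by
    have := (contMDiffAt_iff.1 hf).2
    rwa [ModelWithCorners.range_eq_univ, contDiffWithinAt_univ] at this
  have dmap : ∀ {U : Π y : M, TangentSpace I y}, MDiffAt (T% U) x →
      DifferentiableAt ℝ (mpullback 𝓘(ℝ, E) I φ.symm U) (φ x) := by
    intro U hU
    have := (mdifferentiableWithinAt_univ.2 hU).differentiableWithinAt_mpullbackWithin_vectorField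
    rw [preimage_univ, univ_inter, ModelWithCorners.range_eq_univ, mpullbackWithin_univ] at this
    exact differentiableWithinAt_univ.1 this
  have dmap' : ∀ {U : Π y : M', TangentSpace I' y}, MDiffAt (T% U) (f x) →
      DifferentiableAt ℝ (mpullback 𝓘(ℝ, E') I' ψ.symm U) (ψ (f x)) := by
    intro U hU
    have := (mdifferentiableWithinAt_univ.2 hU).differentiableWithinAt_mpullbackWithin_vectorField
    rw [preimage_univ, univ_inter, ModelWithCorners.range_eq_univ, mpullbackWithin_univ] at this
    exact differentiableWithinAt_univ.1 this
  have dφs : ∀ y ∈ φ.target, MDifferentiableAt 𝓘(ℝ, E) I φ.symm y := fun y hy ↦ by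
    have := mdifferentiableWithinAt_extChartAt_symm (I := I) hy
    rwa [ModelWithCorners.range_eq_univ, mdifferentiableWithinAt_univ] at this
  have hfe : ∀ᶠ y in 𝓝 x, ContMDiffAt I I' 2 f y :=
    (contMDiffAt_iff_contMDiffAt_nhds (by simp)).1 hf
  have hφc : ContinuousAt φ.symm (φ x) := continuousAt_extChartAt_symm x
  have rel : ∀ {U : Π y : M, TangentSpace I y} {U' : Π y : M', TangentSpace I' y},
      (∀ᶠ y in 𝓝 x, mfderiv I I' f y (U y) = U' (f y)) →
      ∀ᶠ y in 𝓝 (φ x), fderiv ℝ F y (mpullback 𝓘(ℝ, E) I φ.symm U y)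
        = mpullback 𝓘(ℝ, E') I' ψ.symm U' (F y) := by
    intro U U' h
    have hc : Filter.Tendsto φ.symm (𝓝 (φ x)) (𝓝 x) := by
      have := hφc.tendsto
      rwa [hxφ] at this
    have ht : φ.target ∈ 𝓝 (φ x) := extChartAt_target_mem_nhds x
    have hsrc : ∀ᶠ y in 𝓝 x, f y ∈ ψ.source :=
      hf.continuousAt.preimage_mem_nhds (extChartAt_source_mem_nhds (f x))
    filter_upwards [hc.eventually h, hc.eventually hfe, hc.eventually hsrc, ht] with y h1 h2 h3 h4
    have hd1 := dφs y h4
    have hd2 : MDifferentiableAt I I' f (φ.symm y) := h2.mdifferentiableAt (by norm_num)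
    have hd3 : MDifferentiableAt I' 𝓘(ℝ, E') ψ (f (φ.symm y)) :=
      mdifferentiableAt_extChartAt (by simpa [hψ] using h3)
    have hFd : fderiv ℝ F y = (mfderiv I' 𝓘(ℝ, E') ψ (f (φ.symm y))).comp
        ((mfderiv I I' f (φ.symm y)).comp (mfderiv 𝓘(ℝ, E) I φ.symm y)) := by
      rw [← mfderiv_eq_fderiv, hF, mfderiv_comp y hd3 (hd2.comp y hd1), mfderiv_comp y hd2 hd1]
      rfl
    have hi1 : (mfderiv 𝓘(ℝ, E) I φ.symm y).IsInvertible := by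
      have := isInvertible_mfderivWithin_extChartAt_symm (I := I) h4
      rwa [ModelWithCorners.range_eq_univ, mfderivWithin_univ] at this
    have hi2 : (mfderiv 𝓘(ℝ, E') I' ψ.symm (F y)).inverse
        = mfderiv I' 𝓘(ℝ, E') ψ (f (φ.symm y)) := by
      have e1 := mfderiv_extChartAt_comp_mfderivWithin_extChartAt_symm' (I := I') h3
      have e2 := mfderivWithin_extChartAt_symm_comp_mfderiv_extChartAt' (I := I') h3
      rw [ModelWithCorners.range_eq_univ, mfderivWithin_univ] at e1 e2
      exact ContinuousLinearMap.inverse_eq e2 e1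
    have hψF : ψ.symm (F y) = f (φ.symm y) := ψ.left_inv h3
    rw [mpullback_apply, mpullback_apply, hi2, hFd]
    have e1 : (U' (ψ.symm (F y)) : E') = U' (f (φ.symm y)) := congrArg (fun z ↦ (U' z : E')) hψF
    have e3 : (mfderiv 𝓘(ℝ, E) I φ.symm y) ((mfderiv 𝓘(ℝ, E) I φ.symm y).inverse (U (φ.symm y)))
      = U (φ.symm y) := hi1.self_apply_inverse _
    have e4 : mfderiv I I' f (φ.symm y) ((mfderiv 𝓘(ℝ, E) I φ.symm y)
      ((mfderiv 𝓘(ℝ, E) I φ.symm y).inverse (U (φ.symm y)))) = U' (f (φ.symm y)) := by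
      rw [e3, h1]
    exact (congrArg (mfderiv I' 𝓘(ℝ, E') ψ (f (φ.symm y)) : E' → E') e4).trans
      (congrArg (mfderiv I' 𝓘(ℝ, E') ψ (f (φ.symm y)) : E' → E') e1.symm)
  have hfd : MDifferentiableAt I I' f x := hf.mdifferentiableAt (by norm_num)
  have hd1 := dφs (φ x) (mem_extChartAt_target x)
  have hd3 : MDifferentiableAt I' 𝓘(ℝ, E') ψ (f x) := mdifferentiableAt_extChartAt (by simp)
  have hFd : fderiv ℝ F (φ x) = (mfderiv I' 𝓘(ℝ, E') ψ (f x)).comp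
      ((mfderiv I I' f x).comp (mfderiv 𝓘(ℝ, E) I φ.symm (φ x))) := by
    have hd2' : MDifferentiableAt 𝓘(ℝ, E) I' (f ∘ φ.symm) (φ x) :=
      MDifferentiableAt.comp _ (by rwa [hxφ]) hd1
    rw [← mfderiv_eq_fderiv, hF, mfderiv_comp_of_eq (y := f x) hd3 hd2' (by simp [hxφ]),
      mfderiv_comp_of_eq (y := x) hfd hd1 hxφ]
    have q1 : (mfderiv I I' f (φ.symm (φ x)) : E →L[ℝ] E') = mfderiv I I' f x :=
      mfderiv_congr_point hxφ
    have q2 : (mfderiv I' 𝓘(ℝ, E') ψ (f (φ.symm (φ x))) : E' →L[ℝ] E')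
        = mfderiv I' 𝓘(ℝ, E') ψ (f x) :=
      mfderiv_congr_point (congrArg f hxφ)
    exact congrArg₂ (fun (a : E' →L[ℝ] E') (b : E →L[ℝ] E') ↦
      a.comp (b.comp (mfderiv 𝓘(ℝ, E) I φ.symm (φ x) : E →L[ℝ] E))) q2 q1
  have hi : (mfderiv I 𝓘(ℝ, E) φ x).inverse = mfderiv 𝓘(ℝ, E) I φ.symm (φ x) := by
    have e1 := mfderiv_extChartAt_comp_mfderivWithin_extChartAt_symm' (I := I)
      (mem_extChartAt_source (I := I) x)
    have e2 := mfderivWithin_extChartAt_symm_comp_mfderiv_extChartAt' (I := I)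
      (mem_extChartAt_source (I := I) x)
    rw [ModelWithCorners.range_eq_univ, mfderivWithin_univ] at e1 e2
    exact ContinuousLinearMap.inverse_eq e1 e2
  have hψi : (mfderiv I' 𝓘(ℝ, E') ψ (f x)).IsInvertible :=
    isInvertible_mfderiv_extChartAt (mem_extChartAt_source (I := I') (f x))
  have main := fderiv_lieBracket_of_related hFc (dmap hV) (dmap hW)
    (by rw [hFx]; exact dmap' hV') (by rw [hFx]; exact dmap' hW') (rel hVV) (rel hWW)
  rw [← mlieBracketWithin_univ, ← mlieBracketWithin_univ, mlieBracketWithin_apply,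
    mlieBracketWithin_apply]
  simp only [preimage_univ, univ_inter, ModelWithCorners.range_eq_univ, mpullbackWithin_univ]
  rw [hFd, hFx] at main
  rw [← hφ, ← hψ, hi]
  have e6 := congrArg (mfderiv I' 𝓘(ℝ, E') ψ (f x)).inverse main
  exact (hψi.inverse_apply_self _).symm.trans e6

end RelatedFields

/-! ### Velocity fields of a smooth action. -/

section FundamentalField

theorem tangentBundle_mk_eq {B M : Type*} [NormedAddCommGroup B] [NormedSpace ℝ B]
    [TopologicalSpace M] [ChartedSpace B M] {p q : M} (h : p = q) {v w : B} (hv : v = w) :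
    (TotalSpace.mk' B p v : TangentBundle 𝓘(ℝ, B) M) = TotalSpace.mk' B q w := by
  subst h hv
  rfl

variable {E : Type*} [NormedAddCommGroup E] [NormedSpace ℝ E]
  {B : Type*} [NormedAddCommGroup B] [NormedSpace ℝ B]
  {G : Type*} [Group G] [TopologicalSpace G] [ChartedSpace E G]
  {M : Type*} [TopologicalSpace M] [ChartedSpace B M] [MulAction G M]

variable (B) in
/-- The velocity field on `M` of the action of the one-parameter group generated by `X`. -/
def fundamentalField (X : GroupLieAlgebra 𝓘(ℝ, E) G) (p : M) : TangentSpace 𝓘(ℝ, B) p :=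
  (mfderiv 𝓘(ℝ, E) 𝓘(ℝ, B) (fun a : G ↦ a • p) 1 : E →L[ℝ] B) X

theorem contMDiff_orbitMap [ContMDiffSMul 𝓘(ℝ, E) 𝓘(ℝ, B) ∞ G M] (p : M) :
    ContMDiff 𝓘(ℝ, E) 𝓘(ℝ, B) ∞ (fun a : G ↦ a • p) :=
  contMDiff_id.smul (I := 𝓘(ℝ, E)) contMDiff_const

theorem contMDiff_translation [ContMDiffSMul 𝓘(ℝ, E) 𝓘(ℝ, B) ∞ G M] (a : G) :
    ContMDiff 𝓘(ℝ, B) 𝓘(ℝ, B) ∞ (fun p : M ↦ a • p) :=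
  ContMDiffSMul.contMDiff_const_smul (I := 𝓘(ℝ, E)) a

variable [IsManifold 𝓘(ℝ, E) ∞ G] [IsManifold 𝓘(ℝ, B) ∞ M] [ContMDiffSMul 𝓘(ℝ, E) 𝓘(ℝ, B) ∞ G M]

/-- The field is the tangent map of the action G × M → M evaluated along the smooth family of
vectors (X, 0_p) at (1, p). The result sits over 1 • p, hence the use of `tangentBundle_mk_eq`. -/
theorem contMDiff_fundamentalField (X : GroupLieAlgebra 𝓘(ℝ, E) G) :
    ContMDiff 𝓘(ℝ, B) 𝓘(ℝ, B).tangent ∞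
      (fun p : M ↦ (fundamentalField B X p : TangentBundle 𝓘(ℝ, B) M)) := by
  have : IsManifold 𝓘(ℝ, E) (∞ + 1) G := inferInstanceAs (IsManifold 𝓘(ℝ, E) ∞ G)
  have : IsManifold 𝓘(ℝ, B) (∞ + 1) M := inferInstanceAs (IsManifold 𝓘(ℝ, B) ∞ M)
  have h0 : ContMDiff 𝓘(ℝ, B) 𝓘(ℝ, B).tangent ∞
      (fun p : M ↦ (TotalSpace.mk' B p 0 : TangentBundle 𝓘(ℝ, B) M)) := contMDiff_zeroSection _ _
  have h1 : ContMDiff 𝓘(ℝ, B) 𝓘(ℝ, E).tangent ∞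
      (fun _ : M ↦ (TotalSpace.mk' E 1 X : TangentBundle 𝓘(ℝ, E) G)) := contMDiff_const
  have h2 : ContMDiff (𝓘(ℝ, E).tangent.prod 𝓘(ℝ, B).tangent) (𝓘(ℝ, E).prod 𝓘(ℝ, B)).tangent ∞
      (equivTangentBundleProd 𝓘(ℝ, E) G 𝓘(ℝ, B) M).symm := contMDiff_equivTangentBundleProd_symm
  have h3 : ContMDiff (𝓘(ℝ, E).prod 𝓘(ℝ, B)).tangent 𝓘(ℝ, B).tangent ∞
      (tangentMap (𝓘(ℝ, E).prod 𝓘(ℝ, B)) 𝓘(ℝ, B) (fun q : G × M ↦ q.1 • q.2)) :=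
    (contMDiff_smul (n := ∞)).contMDiff_tangentMap (by simp)
  refine ((h3.comp h2).comp (h1.prodMk h0)).congr fun p ↦ ?_
  have e := mfderiv_prod_eq_add_apply (I := 𝓘(ℝ, E)) (I' := 𝓘(ℝ, B)) (I'' := 𝓘(ℝ, B))
    (f := fun q : G × M ↦ q.1 • q.2) (p := (1, p)) (v := (X, 0))
    ((contMDiff_smul (n := ∞)).mdifferentiableAt (by simp))
  have e' := e.trans (congrArg₂ (fun x y : B ↦ x + y) rfl
    (map_zero (mfderiv 𝓘(ℝ, B) 𝓘(ℝ, B) (fun z : M ↦ (1 : G) • z) p : B →L[ℝ] B)))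
  exact tangentBundle_mk_eq (one_smul G p).symm (e'.trans (add_zero _)).symm

theorem mdifferentiableAt_fundamentalField (X : GroupLieAlgebra 𝓘(ℝ, E) G) (p : M) :
    MDiffAt (T% (fun p : M ↦ fundamentalField B X p)) p :=
  (contMDiff_fundamentalField X).mdifferentiableAt (by simp)

end FundamentalField

/-! ### Invariant fields and the adjoint action on a Lie group. -/

section LieGroup

open VectorField

variable {E : Type*} [NormedAddCommGroup E] [NormedSpace ℝ E] [FiniteDimensional ℝ E]
  {G : Type*} [Group G] [TopologicalSpace G] [ChartedSpace E G] [LieGroup 𝓘(ℝ, E) ∞ G]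

omit [FiniteDimensional ℝ E] in
variable (E G) in
theorem lieGroup_minSmoothness : LieGroup 𝓘(ℝ, E) (minSmoothness ℝ 3) G := by
  rw [minSmoothness_of_isRCLikeNormedField]
  infer_instance

theorem mdifferentiableAt_mulInvariantVectorField' (X : GroupLieAlgebra 𝓘(ℝ, E) G) (a : G) :
    MDiffAt (T% (mulInvariantVectorField X : Π a : G, TangentSpace 𝓘(ℝ, E) a)) a :=
  have := lieGroup_minSmoothness E G
  mdifferentiableAt_mulInvariantVectorField X

/-- Left and right invariant vector fields commute. -/
theorem mlieBracket_fundamentalField_mulInvariantVectorField (X Y : GroupLieAlgebra 𝓘(ℝ, E) G) :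
    mlieBracket 𝓘(ℝ, E) (fun a : G ↦ fundamentalField E X a) (mulInvariantVectorField Y) 1 = 0 := by
  have := lieGroup_minSmoothness E G
  -- The fields act on different factors of G × G, so both projections show that their bracket
  -- vanishes at (1, 1). Multiplication relates V to the right invariant field of X and W to the
  -- left invariant field of Y.
  let V : Π q : G × G, TangentSpace (𝓘(ℝ, E).prod 𝓘(ℝ, E)) q :=
    fun q ↦ ((fundamentalField E X q.1 : E), (0 : E))
  let W : Π q : G × G, TangentSpace (𝓘(ℝ, E).prod 𝓘(ℝ, E)) q :=
    fun q ↦ ((0 : E), (mulInvariantVectorField Y q.2 : E))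
  have hz : ∀ a : G, MDiffAt (T% (fun a : G ↦ (0 : TangentSpace 𝓘(ℝ, E) a))) a :=
    fun a ↦ (contMDiff_zeroSection ℝ (fun a : G ↦ TangentSpace 𝓘(ℝ, E) a) (n := 1)).mdifferentiableAt
      (by simp)
  have hS : ∀ q, MDifferentiableAt (𝓘(ℝ, E).tangent.prod 𝓘(ℝ, E).tangent)
      (𝓘(ℝ, E).prod 𝓘(ℝ, E)).tangent (equivTangentBundleProd 𝓘(ℝ, E) G 𝓘(ℝ, E) G).symm q :=
    fun q ↦ (contMDiff_equivTangentBundleProd_symm (n := 1)).mdifferentiableAt (by simp)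
  have hV : ∀ q, MDiffAt (T% V) q := fun q ↦
    (hS _).comp q (((mdifferentiableAt_fundamentalField X q.1).comp q mdifferentiableAt_fst).prodMk
      ((hz q.2).comp q mdifferentiableAt_snd))
  have hW : ∀ q, MDiffAt (T% W) q := fun q ↦
    (hS _).comp q (((hz q.1).comp q mdifferentiableAt_fst).prodMk
      ((mdifferentiableAt_mulInvariantVectorField' Y q.2).comp q mdifferentiableAt_snd))
  have h1 := mfderiv_mlieBracket_of_related (I := 𝓘(ℝ, E).prod 𝓘(ℝ, E)) (I' := 𝓘(ℝ, E))
    (f := (Prod.fst : G × G → G)) (x := ((1 : G), (1 : G))) (V := V) (W := W)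
    (V' := fun a ↦ fundamentalField E X a) (W' := 0)
    contMDiffAt_fst (hV _) (hW _) (mdifferentiableAt_fundamentalField X _) (hz _)
    (.of_forall fun q ↦ by rw [mfderiv_fst]; rfl) (.of_forall fun q ↦ by rw [mfderiv_fst]; rfl)
  have h2 := mfderiv_mlieBracket_of_related (I := 𝓘(ℝ, E).prod 𝓘(ℝ, E)) (I' := 𝓘(ℝ, E))
    (f := (Prod.snd : G × G → G)) (x := ((1 : G), (1 : G))) (V := V) (W := W)
    (V' := 0) (W' := mulInvariantVectorField Y)
    contMDiffAt_snd (hV _) (hW _) (hz _) (mdifferentiableAt_mulInvariantVectorField' Y _)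
    (.of_forall fun q ↦ by rw [mfderiv_snd]; rfl) (.of_forall fun q ↦ by rw [mfderiv_snd]; rfl)
  rw [mfderiv_fst, mlieBracket_zero_right] at h1
  rw [mfderiv_snd, mlieBracket_zero_left] at h2
  have h0 : mlieBracket (𝓘(ℝ, E).prod 𝓘(ℝ, E)) V W ((1 : G), (1 : G)) = 0 := Prod.ext h1 h2
  have hmul : ∀ q : G × G, MDifferentiableAt (𝓘(ℝ, E).prod 𝓘(ℝ, E)) 𝓘(ℝ, E)
      (fun q : G × G ↦ q.1 * q.2) q :=
    fun q ↦ (contMDiff_mul 𝓘(ℝ, E) ∞).mdifferentiableAt (by simp)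
  have hr : ∀ b x : G, MDifferentiableAt 𝓘(ℝ, E) 𝓘(ℝ, E) (fun z : G ↦ z * b) x :=
    fun b x ↦ (contMDiff_mul_right (n := ∞)).mdifferentiableAt (by simp)
  have hl : ∀ b x : G, MDifferentiableAt 𝓘(ℝ, E) 𝓘(ℝ, E) (fun z : G ↦ b * z) x :=
    fun b x ↦ (contMDiff_mul_left (n := ∞)).mdifferentiableAt (by simp)
  have h3 := mfderiv_mlieBracket_of_related (I := 𝓘(ℝ, E).prod 𝓘(ℝ, E)) (I' := 𝓘(ℝ, E))
    (f := fun q : G × G ↦ q.1 * q.2) (x := ((1 : G), (1 : G))) (V := V) (W := W)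
    (V' := fun a ↦ fundamentalField E X a) (W' := mulInvariantVectorField Y)
    ((contMDiff_mul 𝓘(ℝ, E) 2).contMDiffAt) (hV _) (hW _)
    (mdifferentiableAt_fundamentalField X _) (mdifferentiableAt_mulInvariantVectorField' Y _)
    (.of_forall fun q ↦ by
      rw [mfderiv_prod_eq_add_apply (hmul q)]
      have e1 : mfderiv 𝓘(ℝ, E) 𝓘(ℝ, E) (fun z : G ↦ z * (q.1 * q.2)) 1 X
          = mfderiv 𝓘(ℝ, E) 𝓘(ℝ, E) (fun z : G ↦ z * q.2) q.1
            (mfderiv 𝓘(ℝ, E) 𝓘(ℝ, E) (fun z : G ↦ z * q.1) 1 X) := by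
        have : (fun z : G ↦ z * (q.1 * q.2)) = (fun z : G ↦ z * q.2) ∘ (fun z : G ↦ z * q.1) := by
          ext z; simp [mul_assoc]
        rw [this]
        exact mfderiv_comp_apply_of_eq (1 : G) (hr _ _) (hr _ _) (one_mul _) X
      exact (congrArg₂ (fun x y : E ↦ x + y) e1.symm (map_zero (mfderiv 𝓘(ℝ, E) 𝓘(ℝ, E)
        (fun z : G ↦ q.1 * z) q.2 : E →L[ℝ] E))).trans (add_zero _))
    (.of_forall fun q ↦ by
      rw [mfderiv_prod_eq_add_apply (hmul q)]
      have e1 : mfderiv 𝓘(ℝ, E) 𝓘(ℝ, E) (fun z : G ↦ (q.1 * q.2) * z) 1 Y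
          = mfderiv 𝓘(ℝ, E) 𝓘(ℝ, E) (fun z : G ↦ q.1 * z) q.2
            (mfderiv 𝓘(ℝ, E) 𝓘(ℝ, E) (fun z : G ↦ q.2 * z) 1 Y) := by
        have : (fun z : G ↦ (q.1 * q.2) * z) = (fun z : G ↦ q.1 * z) ∘ (fun z : G ↦ q.2 * z) := by
          ext z; simp [mul_assoc]
        rw [this]
        exact mfderiv_comp_apply_of_eq (1 : G) (hl _ _) (hl _ _) (mul_one _) Y
      exact (congrArg₂ (fun x y : E ↦ x + y) (map_zero (mfderiv 𝓘(ℝ, E) 𝓘(ℝ, E)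
        (fun z : G ↦ z * q.2) q.1 : E →L[ℝ] E)) e1.symm).trans (zero_add _))
  rw [h0] at h3
  have h4 : mlieBracket 𝓘(ℝ, E) (fun a : G ↦ fundamentalField E X a) (mulInvariantVectorField Y)
      ((1 : G) * 1) = 0 := h3.symm.trans (map_zero _)
  rw [one_mul] at h4
  exact h4

omit [FiniteDimensional ℝ E] in
-- With both base points fixed, the coordinate changes go from a chart to itself and are the
-- identity at its base point.
theorem inTangentCoordinates_of_const {N M M' E' : Type*} [NormedAddCommGroup E'] [NormedSpace ℝ E']
    [TopologicalSpace M] [ChartedSpace E M] [IsManifold 𝓘(ℝ, E) 1 M]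
    [TopologicalSpace M'] [ChartedSpace E' M'] [IsManifold 𝓘(ℝ, E') 1 M'] (x : M) {y : M'}
    {g : N → M'} (hg : ∀ n, g n = y) (Φ : N → E →L[ℝ] E') (n n' : N) :
    inTangentCoordinates 𝓘(ℝ, E) 𝓘(ℝ, E') (fun _ ↦ x) g Φ n n' = Φ n' := by
  obtain rfl : g = fun _ ↦ y := funext hg
  rw [inTangentCoordinates_eq _ _ _ (by simp) (by simp)]
  ext v
  simp only [ContinuousLinearMap.comp_apply]
  rw [(tangentBundleCore 𝓘(ℝ, E) M).coordChange_self (achart E x) x (mem_chart_source E x),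
    (tangentBundleCore 𝓘(ℝ, E') M').coordChange_self (achart E' y) y (mem_chart_source E' y)]

omit [FiniteDimensional ℝ E] in
/-- The derivative at a point of a smooth family of maps depends smoothly on the parameter, if the
maps have the same value at the point. -/
theorem contMDiffAt_mfderiv_of_const {B N M M' : Type*} [NormedAddCommGroup B] [NormedSpace ℝ B]
    {E' : Type*} [NormedAddCommGroup E'] [NormedSpace ℝ E']
    [TopologicalSpace N] [ChartedSpace B N] [TopologicalSpace M] [ChartedSpace E M]
    [TopologicalSpace M'] [ChartedSpace E' M'] [IsManifold 𝓘(ℝ, B) ∞ N]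
    [IsManifold 𝓘(ℝ, E) ∞ M] [IsManifold 𝓘(ℝ, E') ∞ M'] {f : N → M → M'} {x : M} {y : M'} {n : N}
    (hf : ContMDiffAt (𝓘(ℝ, B).prod 𝓘(ℝ, E)) 𝓘(ℝ, E') ∞ (Function.uncurry f) (n, x))
    (h : ∀ n, f n x = y) :
    ContMDiffAt (M' := E →L[ℝ] E') 𝓘(ℝ, B) 𝓘(ℝ, E →L[ℝ] E') ∞
      (fun n ↦ (mfderiv 𝓘(ℝ, E) 𝓘(ℝ, E') (f n) x : E →L[ℝ] E')) n := by
  have h1 := ContMDiffAt.mfderiv (m := ∞) f (fun _ ↦ x) hf contMDiffAt_const (by simp)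
  let Φ : N → E →L[ℝ] E' := fun n ↦ mfderiv 𝓘(ℝ, E) 𝓘(ℝ, E') (f n) x
  exact h1.congr_of_eventuallyEq
    (.of_forall fun n' ↦ (inTangentCoordinates_of_const x h Φ n n').symm)

theorem contMDiff_adjointAction_inv :
    ContMDiff (M' := E →L[ℝ] E) 𝓘(ℝ, E) 𝓘(ℝ, E →L[ℝ] E) ∞
      (fun a : G ↦ (adjointAction E a⁻¹ : E →L[ℝ] E)) := by
  intro a
  refine contMDiffAt_mfderiv_of_const (f := fun a x : G ↦ a⁻¹ * x * a⁻¹⁻¹) (y := 1) ?_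
    (fun n ↦ by simp)
  have h1 : ContMDiff (𝓘(ℝ, E).prod 𝓘(ℝ, E)) 𝓘(ℝ, E) ∞ (fun q : G × G ↦ q.1⁻¹) :=
    contMDiff_fst.inv
  exact ((h1.mul contMDiff_snd).mul h1.inv).contMDiffAt

theorem mdifferentiableAt_adjointAction_inv_apply (Y : GroupLieAlgebra 𝓘(ℝ, E) G) (a : G) :
    MDifferentiableAt (M' := E) 𝓘(ℝ, E) 𝓘(ℝ, E) (fun a : G ↦ adjointAction E a⁻¹ Y) a :=
  (contMDiff_adjointAction_inv.clm_apply contMDiff_const).mdifferentiableAt (by simp)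

theorem mdifferentiableAt_conj (a x : G) :
    MDifferentiableAt 𝓘(ℝ, E) 𝓘(ℝ, E) (fun x : G ↦ a * x * a⁻¹) x :=
  ((contMDiff_mul_left (n := ∞)).mul contMDiff_const).mdifferentiableAt (by simp)

theorem adjointAction_mul (a b : G) (X : GroupLieAlgebra 𝓘(ℝ, E) G) :
    adjointAction E (a * b) X = adjointAction E a (adjointAction E b X) := by
  have : (fun x : G ↦ (a * b) * x * (a * b)⁻¹)
      = (fun x : G ↦ a * x * a⁻¹) ∘ (fun x : G ↦ b * x * b⁻¹) := by
    ext x; simp [mul_assoc]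
  unfold adjointAction
  rw [this]
  exact mfderiv_comp_apply_of_eq (1 : G) (mdifferentiableAt_conj _ _) (mdifferentiableAt_conj _ _)
    (by simp) X

theorem adjointAction_one (X : GroupLieAlgebra 𝓘(ℝ, E) G) : adjointAction E (1 : G) X = X := by
  have : (fun x : G ↦ (1 : G) * x * (1 : G)⁻¹) = id := by
    ext x; simp
  unfold adjointAction
  rw [this, mfderiv_id]
  rfl

theorem adjointAction_inv_apply (a : G) (X : GroupLieAlgebra 𝓘(ℝ, E) G) :
    adjointAction E a⁻¹ (adjointAction E a X) = X := by
  rw [← adjointAction_mul, inv_mul_cancel, adjointAction_one]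

theorem adjointAction_apply_inv (a : G) (X : GroupLieAlgebra 𝓘(ℝ, E) G) :
    adjointAction E a (adjointAction E a⁻¹ X) = X := by
  rw [← adjointAction_mul, mul_inv_cancel, adjointAction_one]

/-- From x a = a (a⁻¹ x a): in a left invariant frame, the right invariant field of Y has the
coefficients of Ad(a⁻¹) Y. -/
theorem fundamentalField_eq_mulInvariantVectorField (Y : GroupLieAlgebra 𝓘(ℝ, E) G) (a : G) :
    fundamentalField E Y a = mulInvariantVectorField (adjointAction E a⁻¹ Y) a := by
  have : (fun x : G ↦ x • a) = (fun x : G ↦ a * x) ∘ (fun x : G ↦ a⁻¹ * x * a⁻¹⁻¹) := by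
    ext x; simp [mul_assoc]
  unfold adjointAction fundamentalField mulInvariantVectorField
  rw [this]
  exact mfderiv_comp_apply_of_eq (1 : G)
    ((contMDiff_mul_left (n := ∞)).mdifferentiableAt (by simp)) (mdifferentiableAt_conj _ _)
    (by simp) Y

omit [FiniteDimensional ℝ E] [LieGroup 𝓘(ℝ, E) ∞ G] in
theorem mulInvariantVectorField_one' (X : GroupLieAlgebra 𝓘(ℝ, E) G) :
    mulInvariantVectorField X (1 : G) = X := by
  unfold mulInvariantVectorField
  rw [show (fun x : G ↦ 1 * x) = id by ext; simp, mfderiv_id]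
  rfl

theorem mlieBracket_sum_smul_right {ι : Type*} (s : Finset ι)
    {V : Π a : G, TangentSpace 𝓘(ℝ, E) a} {e : ι → Π a : G, TangentSpace 𝓘(ℝ, E) a}
    {f : ι → G → ℝ} {x : G} (he : ∀ i, MDiffAt (T% (e i)) x) (hf : ∀ i, MDiffAt (f i) x) :
    mlieBracket 𝓘(ℝ, E) V (∑ i ∈ s, f i • e i) x
      = ∑ i ∈ s, (mvfderiv 𝓘(ℝ, E) (f i) x (V x) • e i x + f i x • mlieBracket 𝓘(ℝ, E) V (e i) x)
    := by
  classical
  induction s using Finset.induction_on with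
  | empty => simp
  | insert i s hi ih =>
    rw [Finset.sum_insert hi, Finset.sum_insert hi, mlieBracket_add_right, ih,
      mlieBracket_smul_right (hf i) (he i)]
    · exact (hf i).smul_section (he i)
    · have h := MDifferentiableAt.sum_section (s := s) (t := fun i ↦ f i • e i)
        fun i _ ↦ (hf i).smul_section (he i)
      simpa only [Finset.sum_apply] using h

/-- Expand the right invariant field of Y in a left invariant frame and bracket it with a field V
with V(1) = X. The Leibniz rule gives the derivative L of the coefficients plus the brackets of V
with the frame. For V left invariant the total is 0 and the second term is [X, Y], so L = -[X, Y];
for V right invariant the second term is 0, so the total is L. -/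
theorem mfderiv_adjointAction_inv_and_mlieBracket (X Y : GroupLieAlgebra 𝓘(ℝ, E) G) :
    mvfderiv (F := E) 𝓘(ℝ, E) (fun b : G ↦ adjointAction E b⁻¹ Y) 1 X = -⁅X, Y⁆ ∧
    mlieBracket 𝓘(ℝ, E) (fun a : G ↦ fundamentalField E X a) (fun a : G ↦ fundamentalField E Y a) 1
      = mvfderiv (F := E) 𝓘(ℝ, E) (fun b : G ↦ adjointAction E b⁻¹ Y) 1 X := by
  let b := Module.finBasis ℝ E
  let W : G → E := fun b : G ↦ adjointAction E b⁻¹ Y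
  have hW : MDifferentiableAt 𝓘(ℝ, E) 𝓘(ℝ, E) W 1 := mdifferentiableAt_adjointAction_inv_apply Y 1
  let c : ∀ i, E →L[ℝ] ℝ := fun i ↦ LinearMap.toContinuousLinearMap (b.coord i)
  let f : Fin (Module.finrank ℝ E) → G → ℝ := fun i a ↦ c i (W a)
  have hf : ∀ i, MDiffAt (f i) (1 : G) := fun i ↦ (c i).mdifferentiableAt.comp (1 : G) hW
  let e : Fin (Module.finrank ℝ E) → Π a : G, TangentSpace 𝓘(ℝ, E) a :=
    fun i ↦ mulInvariantVectorField (b i : GroupLieAlgebra 𝓘(ℝ, E) G)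
  have he : ∀ i, MDiffAt (T% (e i)) (1 : G) :=
    fun i ↦ mdifferentiableAt_mulInvariantVectorField' _ _
  have hsum : (fun a : G ↦ fundamentalField E Y a) = ∑ i, f i • e i := by
    ext a
    have h1 : W a = ∑ i, f i a • b i := (b.sum_repr (W a)).symm
    have h2 := congrArg (mfderiv 𝓘(ℝ, E) 𝓘(ℝ, E) (fun x : G ↦ a * x) 1 : E →L[ℝ] E) h1
    rw [fundamentalField_eq_mulInvariantVectorField, Finset.sum_apply]
    exact h2.trans ((map_sum _ _ _).trans (Finset.sum_congr rfl fun i _ ↦ map_smul _ _ _))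
  let L : GroupLieAlgebra 𝓘(ℝ, E) G := mvfderiv 𝓘(ℝ, E) W 1 X
  have hd : ∀ i, mvfderiv 𝓘(ℝ, E) (f i) 1 X = c i L := fun i ↦ by
    have := mvfderiv_comp_apply (I := 𝓘(ℝ, E)) (1 : G) ((c i).mdifferentiableAt (x := W 1)) hW X
    refine this.trans ?_
    simp [mvfderiv]
    rfl
  have key : ∀ V : Π a : G, TangentSpace 𝓘(ℝ, E) a, V 1 = X →
      mlieBracket 𝓘(ℝ, E) V (fun a : G ↦ fundamentalField E Y a) 1 = L
        + ∑ i, f i 1 • mlieBracket 𝓘(ℝ, E) V (e i) 1 := by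
    intro V hV
    rw [hsum, mlieBracket_sum_smul_right _ he hf, Finset.sum_add_distrib, hV]
    congr 1
    refine Eq.trans (Finset.sum_congr rfl fun i _ ↦ ?_) (b.sum_repr L)
    have h4 : e i 1 = b i := mulInvariantVectorField_one' _
    exact congrArg₂ (fun (t : ℝ) (v : E) ↦ t • v) (hd i) h4
  have h1 := key (mulInvariantVectorField X) (mulInvariantVectorField_one' X)
  rw [mlieBracket_swap_apply, mlieBracket_fundamentalField_mulInvariantVectorField, neg_zero] at h1
  have h2 : ∑ i, f i 1 • mlieBracket 𝓘(ℝ, E) (mulInvariantVectorField X) (e i) 1 = ⁅X, Y⁆ := by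
    have := lieGroup_minSmoothness E G
    let b' : Fin (Module.finrank ℝ E) → GroupLieAlgebra 𝓘(ℝ, E) G := fun i ↦ b i
    have h3 : Y = ∑ i, f i 1 • b' i := by
      have h4 : W 1 = Y := by
        simp only [W, inv_one]
        exact adjointAction_one Y
      exact h4.symm.trans (b.sum_repr (W 1)).symm
    refine Eq.trans (Finset.sum_congr rfl fun i _ ↦ ?_)
      ((lie_sum (s := Finset.univ) (fun i ↦ f i 1 • b' i) X).symm.trans (congrArg (⁅X, ·⁆) h3.symm))
    exact (lie_smul (f i 1) X (b' i)).symm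
  rw [h2] at h1
  refine ⟨eq_neg_of_add_eq_zero_left h1.symm, ?_⟩
  have h3 := key (fun a : G ↦ fundamentalField E X a) (by
    rw [fundamentalField_eq_mulInvariantVectorField, inv_one, adjointAction_one]
    exact mulInvariantVectorField_one' X)
  refine h3.trans ((congrArg (L + ·) (Finset.sum_eq_zero fun i _ ↦ ?_)).trans (add_zero L))
  exact (congrArg (f i 1 • ·) (mlieBracket_fundamentalField_mulInvariantVectorField X _)).trans
    (smul_zero _)

/-- The derivative at `1` of `b ↦ Ad(b⁻¹) Y` in the direction `X` is `-[X, Y]`. -/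
theorem mfderiv_adjointAction_inv (X Y : GroupLieAlgebra 𝓘(ℝ, E) G) :
    mvfderiv (F := E) 𝓘(ℝ, E) (fun b : G ↦ adjointAction E b⁻¹ Y) 1 X = -⁅X, Y⁆ :=
  (mfderiv_adjointAction_inv_and_mlieBracket X Y).1

theorem mlieBracket_fundamentalField_one (X Y : GroupLieAlgebra 𝓘(ℝ, E) G) :
    mlieBracket 𝓘(ℝ, E) (fun a : G ↦ fundamentalField E X a) (fun a : G ↦ fundamentalField E Y a) 1
      = -⁅X, Y⁆ :=
  (mfderiv_adjointAction_inv_and_mlieBracket X Y).2.trans (mfderiv_adjointAction_inv X Y)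

theorem adjointAction_lie (a : G) (X Y : GroupLieAlgebra 𝓘(ℝ, E) G) :
    adjointAction E a ⁅X, Y⁆ = ⁅adjointAction E a X, adjointAction E a Y⁆ := by
  let T : E →L[ℝ] E := adjointAction E a
  let Z : GroupLieAlgebra 𝓘(ℝ, E) G := ⁅X, Y⁆
  let W : G → E := fun b : G ↦ adjointAction E b⁻¹ Y
  let W' : G → E := fun b : G ↦ adjointAction E b⁻¹ (adjointAction E a Y)
  -- Differentiating this identity at 1 along X gives the claim, because the derivative of b ↦
  -- Ad(b⁻¹) Y is -[·, Y].
  have h : T ∘ W = W' ∘ (fun x : G ↦ a * x * a⁻¹) := by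
    ext b
    change adjointAction E a (adjointAction E b⁻¹ Y)
      = adjointAction E (a * b * a⁻¹)⁻¹ (adjointAction E a Y)
    rw [← adjointAction_mul, ← adjointAction_mul]
    congr 2
    simp [mul_assoc]
  have h1 : mvfderiv (F := E) 𝓘(ℝ, E) (T ∘ W) 1 X = T (-Z) := by
    have h2 := mfderiv_comp_apply (I := 𝓘(ℝ, E)) (I' := 𝓘(ℝ, E)) (I'' := 𝓘(ℝ, E)) (g := T) (1 : G)
      (T.mdifferentiableAt (x := W 1)) (mdifferentiableAt_adjointAction_inv_apply Y 1) X
    refine h2.trans ?_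
    rw [mfderiv_eq_fderiv, T.fderiv]
    exact congrArg T (mfderiv_adjointAction_inv X Y)
  have h2 : mvfderiv (F := E) 𝓘(ℝ, E) (W' ∘ (fun x : G ↦ a * x * a⁻¹)) 1 X
      = (-⁅adjointAction E a X, adjointAction E a Y⁆ : GroupLieAlgebra 𝓘(ℝ, E) G) := by
    have h3 : a * 1 * a⁻¹ = 1 := by simp
    have h4 := mfderiv_comp_apply_of_eq (I := 𝓘(ℝ, E)) (I' := 𝓘(ℝ, E)) (I'' := 𝓘(ℝ, E)) (g := W')
      (1 : G) (mdifferentiableAt_adjointAction_inv_apply (adjointAction E a Y) (1 : G))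
      (mdifferentiableAt_conj a 1) h3 X
    exact h4.trans (mfderiv_adjointAction_inv (adjointAction E a X) (adjointAction E a Y))
  rw [h] at h1
  have h3 : T (-Z) = -T Z := map_neg T _
  exact neg_injective (h3.symm.trans (h1.symm.trans h2))

end LieGroup

/-! ### Equivariance and brackets of the action fields. -/

section Action

open VectorField

variable {E : Type*} [NormedAddCommGroup E] [NormedSpace ℝ E]
  {B : Type*} [NormedAddCommGroup B] [NormedSpace ℝ B]
  {G : Type*} [Group G] [TopologicalSpace G] [ChartedSpace E G] [LieGroup 𝓘(ℝ, E) ∞ G]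
  {M : Type*} [TopologicalSpace M] [ChartedSpace B M] [MulAction G M]
  [ContMDiffSMul 𝓘(ℝ, E) 𝓘(ℝ, B) ∞ G M]

/-- The orbit map thus relates right invariant fields on G to action fields on M, which carries the
bracket formula from G to M. -/
theorem mfderiv_orbitMap_apply (p : M) (b : G) (X : GroupLieAlgebra 𝓘(ℝ, E) G) :
    mfderiv 𝓘(ℝ, E) 𝓘(ℝ, B) (fun a : G ↦ a • p) b (fundamentalField E X b)
      = fundamentalField B X (b • p) := by
  have : (fun a : G ↦ a • b • p) = (fun a : G ↦ a • p) ∘ (fun a : G ↦ a * b) := by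
    ext a; simp [mul_smul]
  unfold fundamentalField
  rw [this]
  exact (mfderiv_comp_apply_of_eq (1 : G) ((contMDiff_orbitMap p).mdifferentiableAt (by simp))
    ((contMDiff_mul_right (n := ∞)).mdifferentiableAt (by simp)) (one_mul b) X).symm

/-- Differentiate b a p = a (a⁻¹ b a) p in b at 1. -/
theorem fundamentalField_smul (a : G) (p : M) (X : GroupLieAlgebra 𝓘(ℝ, E) G) :
    fundamentalField B X (a • p)
      = mfderiv 𝓘(ℝ, B) 𝓘(ℝ, B) (fun q : M ↦ a • q) p
        (fundamentalField B (adjointAction E a⁻¹ X) p) := by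
  have : (fun b : G ↦ b • a • p)
      = (fun q : M ↦ a • q) ∘ (fun b : G ↦ b • p) ∘ (fun x : G ↦ a⁻¹ * x * a⁻¹⁻¹) := by
    ext b; simp [mul_smul]
  have hc : MDifferentiableAt 𝓘(ℝ, E) 𝓘(ℝ, E) (fun x : G ↦ a⁻¹ * x * a⁻¹⁻¹) 1 :=
    ((contMDiff_mul_left (n := ∞)).mul contMDiff_const).mdifferentiableAt (by simp)
  have ho : ∀ b : G, MDifferentiableAt 𝓘(ℝ, E) 𝓘(ℝ, B) (fun b : G ↦ b • p) b := fun b ↦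
    (contMDiff_orbitMap p).mdifferentiableAt (by simp)
  unfold fundamentalField adjointAction
  rw [this]
  refine (mfderiv_comp_apply_of_eq (I := 𝓘(ℝ, E)) (I' := 𝓘(ℝ, B)) (I'' := 𝓘(ℝ, B)) (y := p) (1 : G)
    ((contMDiff_translation (E := E) a).mdifferentiableAt (by simp)) ((ho _).comp 1 hc)
    (by simp) X).trans ?_
  congr 1
  exact mfderiv_comp_apply_of_eq (1 : G) (ho _) hc (by simp) X

theorem fundamentalField_add (X Y : GroupLieAlgebra 𝓘(ℝ, E) G) (p : M) :
    fundamentalField B (X + Y) p = fundamentalField B X p + fundamentalField B Y p :=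
  map_add (mfderiv 𝓘(ℝ, E) 𝓘(ℝ, B) (fun a : G ↦ a • p) 1 : E →L[ℝ] B) _ _

/-- The bracket of the fields of an action is minus the field of the bracket. -/
theorem mlieBracket_fundamentalField [FiniteDimensional ℝ E] [CompleteSpace B]
    [IsManifold 𝓘(ℝ, B) ∞ M] (X Y : GroupLieAlgebra 𝓘(ℝ, E) G) (p : M) :
    mlieBracket 𝓘(ℝ, B) (fun q : M ↦ fundamentalField B X q) (fun q : M ↦ fundamentalField B Y q) p
      = -fundamentalField B ⁅X, Y⁆ p := by
  have := FiniteDimensional.complete ℝ E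
  have h := mfderiv_mlieBracket_of_related (I := 𝓘(ℝ, E)) (I' := 𝓘(ℝ, B))
    (f := fun a : G ↦ a • p) (x := 1) (V := fun a ↦ fundamentalField E X a)
    (W := fun a ↦ fundamentalField E Y a)
    (V' := fun a ↦ fundamentalField B X a) (W' := fun a ↦ fundamentalField B Y a)
    (((contMDiff_orbitMap p).of_le ENat.LEInfty.out).contMDiffAt)
    (mdifferentiableAt_fundamentalField _ _) (mdifferentiableAt_fundamentalField _ _)
    (mdifferentiableAt_fundamentalField _ _) (mdifferentiableAt_fundamentalField _ _)
    (.of_forall fun b ↦ mfderiv_orbitMap_apply p b X)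
    (.of_forall fun b ↦ mfderiv_orbitMap_apply p b Y)
  rw [mlieBracket_fundamentalField_one] at h
  have h2 := (map_neg (mfderiv 𝓘(ℝ, E) 𝓘(ℝ, B) (fun a : G ↦ a • p) 1 : E →L[ℝ] B) ⁅X, Y⁆).symm.trans
    h
  rw [one_smul] at h2
  exact h2.symm

end Action

/-! ### Local sections and fibre curves of submersions. -/

section Submersion

variable {E : Type*} [NormedAddCommGroup E] [NormedSpace ℝ E]
  {B : Type*} [NormedAddCommGroup B] [NormedSpace ℝ B]
  {M : Type*} [TopologicalSpace M] [ChartedSpace E M] [IsManifold 𝓘(ℝ, E) ∞ M]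
  {N : Type*} [TopologicalSpace N] [ChartedSpace B N] [IsManifold 𝓘(ℝ, B) ∞ N]
  {f : M → N} {x : M}

namespace Manifold.IsSubmersionAt

omit [IsManifold 𝓘(ℝ, E) ∞ M] [IsManifold 𝓘(ℝ, B) ∞ N] in
theorem codChart_apply (h : IsSubmersionAt 𝓘(ℝ, E) 𝓘(ℝ, B) ∞ f x) {w : E}
    (hw : w ∈ h.domChart.target) :
    h.codChart (f (h.domChart.symm w)) = (h.equiv w).1 := by
  have h1 : w ∈ (h.domChart.extend 𝓘(ℝ, E)).target := by simpa using hw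
  simpa using h.writtenInCharts h1

/-- A submersion has smooth local sections. -/
theorem exists_local_section (h : IsSubmersionAt 𝓘(ℝ, E) 𝓘(ℝ, B) ∞ f x) :
    ∃ s : N → M, ContMDiffAt 𝓘(ℝ, B) 𝓘(ℝ, E) ∞ s (f x) ∧ s (f x) = x ∧
      ∀ᶠ q in 𝓝 (f x), f (s q) = q := by
  -- In the adapted charts f is a linear projection. The section is the slice whose complementary
  -- coordinate is frozen at its value at x.
  let L : B → E := fun w ↦ h.equiv.symm (w, (h.equiv (h.domChart x)).2)
  have hL : ContDiff ℝ ∞ L := h.equiv.symm.contDiff.comp (contDiff_id.prodMk contDiff_const)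
  have hx : h.domChart x ∈ h.domChart.target := h.domChart.map_source h.mem_domChart_source
  have h0 : L (h.codChart (f x)) = h.domChart x := by
    have := h.codChart_apply hx
    rw [h.domChart.left_inv h.mem_domChart_source] at this
    simp only [L]
    rw [this]
    simp
  have h1 : ContMDiffAt 𝓘(ℝ, B) 𝓘(ℝ, E) ∞ (fun q ↦ L (h.codChart q)) (f x) :=
    hL.contMDiff.contMDiffAt.comp (f x)
      (contMDiffAt_of_mem_maximalAtlas h.codChart_mem_maximalAtlas h.mem_codChart_source)
  refine ⟨fun q ↦ h.domChart.symm (L (h.codChart q)), ?_, ?_, ?_⟩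
  · refine ContMDiffAt.comp (f x) ?_ h1
    rw [h0]
    exact (contMDiffOn_symm_of_mem_maximalAtlas h.domChart_mem_maximalAtlas).contMDiffAt
      (h.domChart.open_target.mem_nhds hx)
  · change h.domChart.symm (L (h.codChart (f x))) = x
    rw [h0, h.domChart.left_inv h.mem_domChart_source]
  · have h2 : ∀ᶠ q in 𝓝 (f x), L (h.codChart q) ∈ h.domChart.target :=
      h1.continuousAt (h.domChart.open_target.mem_nhds (h0 ▸ hx))
    filter_upwards [h2, h.codChart.open_source.mem_nhds h.mem_codChart_source] with q hq hq'
    refine h.codChart.injOn (h.source_subset_preimage_source (h.domChart.map_target hq)) hq' ?_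
    rw [h.codChart_apply hq]
    simp [L]

theorem mfderiv_surjective (h : IsSubmersionAt 𝓘(ℝ, E) 𝓘(ℝ, B) ∞ f x) :
    Function.Surjective (mfderiv 𝓘(ℝ, E) 𝓘(ℝ, B) f x) := by
  obtain ⟨s, hs, hsx, hfs⟩ := h.exists_local_section
  intro w
  have h1 : f ∘ s =ᶠ[𝓝 (f x)] id := hfs
  have h2 := h1.mfderiv_eq (I := 𝓘(ℝ, B)) (I' := 𝓘(ℝ, B))
  rw [mfderiv_id] at h2
  refine ⟨mfderiv 𝓘(ℝ, B) 𝓘(ℝ, E) s (f x) w, ?_⟩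
  have h3 := mfderiv_comp_apply_of_eq (I := 𝓘(ℝ, B)) (I' := 𝓘(ℝ, E)) (I'' := 𝓘(ℝ, B)) (f x)
    (h.contMDiffAt.mdifferentiableAt (by simp)) (hs.mdifferentiableAt (by simp)) hsx w
  exact h3.symm.trans (congrArg (fun T : B →L[ℝ] B ↦ T w) h2)

/-- A vector in the kernel of the derivative of a submersion is the velocity of a curve in the
fibre. -/
theorem exists_curve (h : IsSubmersionAt 𝓘(ℝ, E) 𝓘(ℝ, B) ∞ f x) (w : TangentSpace 𝓘(ℝ, E) x)
    (hw : mfderiv 𝓘(ℝ, E) 𝓘(ℝ, B) f x w = 0) :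
    ∃ γ : ℝ → M, ContMDiffAt 𝓘(ℝ, ℝ) 𝓘(ℝ, E) ∞ γ 0 ∧ γ 0 = x ∧
      mfderiv 𝓘(ℝ, ℝ) 𝓘(ℝ, E) γ 0 (1 : ℝ) = (w : E) ∧ ∀ᶠ t in 𝓝 0, f (γ t) = f x := by
  have hx : h.domChart x ∈ h.domChart.target := h.domChart.map_source h.mem_domChart_source
  have hφ : MDifferentiableAt 𝓘(ℝ, E) 𝓘(ℝ, E) h.domChart x :=
    (contMDiffAt_of_mem_maximalAtlas h.domChart_mem_maximalAtlas
      h.mem_domChart_source).mdifferentiableAt (by simp)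
  have hψ : MDifferentiableAt 𝓘(ℝ, B) 𝓘(ℝ, B) h.codChart (f x) :=
    (contMDiffAt_of_mem_maximalAtlas h.codChart_mem_maximalAtlas
      h.mem_codChart_source).mdifferentiableAt (by simp)
  have hφ' : ContMDiffAt 𝓘(ℝ, E) 𝓘(ℝ, E) ∞ h.domChart.symm (h.domChart x) :=
    (contMDiffOn_symm_of_mem_maximalAtlas h.domChart_mem_maximalAtlas).contMDiffAt
      (h.domChart.open_target.mem_nhds hx)
  let w' : E := mfderiv 𝓘(ℝ, E) 𝓘(ℝ, E) h.domChart x w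
  let L : E →L[ℝ] B := (ContinuousLinearMap.fst ℝ B h.complement).comp
    (h.equiv : E →L[ℝ] B × h.complement)
  have e1 : L w' = 0 := by
    have h1 : h.codChart ∘ f =ᶠ[𝓝 x] L ∘ h.domChart := by
      filter_upwards [h.domChart.open_source.mem_nhds h.mem_domChart_source] with y hy
      have := h.codChart_apply (h.domChart.map_source hy)
      rwa [h.domChart.left_inv hy] at this
    have h2 := h1.mfderiv_eq (I := 𝓘(ℝ, E)) (I' := 𝓘(ℝ, B))
    have h3 := mfderiv_comp_apply (I := 𝓘(ℝ, E)) (I' := 𝓘(ℝ, B)) (I'' := 𝓘(ℝ, B)) x hψ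
      (h.contMDiffAt.mdifferentiableAt (by simp)) w
    have h4 := mfderiv_comp_apply (I := 𝓘(ℝ, E)) (I' := 𝓘(ℝ, E)) (I'' := 𝓘(ℝ, B)) (g := L) x
      (L.mdifferentiableAt (x := h.domChart x)) hφ w
    rw [mfderiv_eq_fderiv, L.fderiv] at h4
    rw [hw] at h3
    exact h4.symm.trans ((congrArg (fun T : E →L[ℝ] B ↦ T w) h2.symm).trans
      (h3.trans (map_zero (mfderiv 𝓘(ℝ, B) 𝓘(ℝ, B) h.codChart (f x) : B →L[ℝ] B))))
  -- A straight line in the chart whose direction is killed by the projection L stays in the fibre.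
  let c : ℝ → E := fun t ↦ h.domChart x + t • w'
  have hc : ContDiff ℝ ∞ c := contDiff_const.add (contDiff_id.smul contDiff_const)
  have hc0 : c 0 = h.domChart x := by simp [c]
  have hd : HasDerivAt c w' 0 := by
    have h1 := ((hasDerivAt_id (0 : ℝ)).smul_const w').const_add (h.domChart x)
    rw [one_smul] at h1
    exact h1
  have hγ : ContMDiffAt 𝓘(ℝ, ℝ) 𝓘(ℝ, E) ∞ (h.domChart.symm ∘ c) 0 :=
    ContMDiffAt.comp 0 (hc0 ▸ hφ') hc.contMDiff.contMDiffAt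
  refine ⟨h.domChart.symm ∘ c, hγ, ?_, ?_, ?_⟩
  · simp [hc0, h.domChart.left_inv h.mem_domChart_source]
  · have h1 := mfderiv_comp_apply_of_eq (I := 𝓘(ℝ, ℝ)) (I' := 𝓘(ℝ, E)) (I'' := 𝓘(ℝ, E)) (0 : ℝ)
      (hφ'.mdifferentiableAt (by simp))
      (hc.contMDiff.mdifferentiableAt (by simp)) hc0 (1 : ℝ)
    have h2 : mfderiv 𝓘(ℝ, ℝ) 𝓘(ℝ, E) c 0 (1 : ℝ) = w' := by
      rw [mfderiv_eq_fderiv]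
      exact (congrArg (fun T : ℝ →L[ℝ] E ↦ T 1) hd.hasFDerivAt.fderiv).trans (one_smul ℝ w')
    have h3 : h.domChart.symm ∘ h.domChart =ᶠ[𝓝 x] id := by
      filter_upwards [h.domChart.open_source.mem_nhds h.mem_domChart_source] with y hy
      exact h.domChart.left_inv hy
    have h4 := h3.mfderiv_eq (I := 𝓘(ℝ, E)) (I' := 𝓘(ℝ, E))
    have h5 := mfderiv_comp_apply (I := 𝓘(ℝ, E)) (I' := 𝓘(ℝ, E)) (I'' := 𝓘(ℝ, E)) x
      (hφ'.mdifferentiableAt (by simp)) hφ w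
    rw [mfderiv_id] at h4
    exact h1.trans ((congrArg (mfderiv 𝓘(ℝ, E) 𝓘(ℝ, E) h.domChart.symm (h.domChart x) : E →L[ℝ] E)
      h2).trans (h5.symm.trans (congrArg (fun T : E →L[ℝ] E ↦ T w) h4)))
  · have h2 : ∀ᶠ t in 𝓝 0, c t ∈ h.domChart.target :=
      hc.continuous.continuousAt (h.domChart.open_target.mem_nhds (hc0 ▸ hx))
    filter_upwards [h2] with t ht
    refine h.codChart.injOn (h.source_subset_preimage_source (h.domChart.map_target ht))
      h.mem_codChart_source ?_
    have h3 := h.codChart_apply hx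
    rw [h.domChart.left_inv h.mem_domChart_source] at h3
    rw [h3]
    refine (h.codChart_apply ht).trans ?_
    have h4 : L (c t) = L (h.domChart x) := by
      simp only [c, map_add, map_smul, e1, smul_zero, add_zero]
    exact h4

end Manifold.IsSubmersionAt

end Submersion

/-! ### The smooth action on G/H and the kernel of the derivative of the projection. -/

section Quotient

variable {E : Type*} [NormedAddCommGroup E] [NormedSpace ℝ E]
  {F : Type*} [NormedAddCommGroup F] [NormedSpace ℝ F]
  {B : Type*} [NormedAddCommGroup B] [NormedSpace ℝ B]
  {G : Type*} [Group G] [TopologicalSpace G] [ChartedSpace E G] [LieGroup 𝓘(ℝ, E) ∞ G]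
  {H : Subgroup G} [ChartedSpace B (G ⧸ H)] [IsManifold 𝓘(ℝ, B) ∞ (G ⧸ H)]

/-- Near a given point the action is (a, q) ↦ π(a s(q)) for a smooth local section s of π. -/
theorem contMDiffSMul_quotient
    (hπ : IsSubmersion 𝓘(ℝ, E) 𝓘(ℝ, B) ∞ (fun a : G ↦ (a : G ⧸ H))) :
    ContMDiffSMul 𝓘(ℝ, E) 𝓘(ℝ, B) ∞ G (G ⧸ H) where
  contMDiff_smul := by
    rintro ⟨a, p⟩
    obtain ⟨b, rfl⟩ := QuotientGroup.mk_surjective p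
    obtain ⟨s, hs, -, hfs⟩ := (hπ.isSubmersionAt b).exists_local_section
    have h1 : ContMDiffAt (𝓘(ℝ, E).prod 𝓘(ℝ, B)) 𝓘(ℝ, B) ∞
        (fun q : G × G ⧸ H ↦ ((q.1 * s q.2 : G) : G ⧸ H)) (a, (b : G ⧸ H)) :=
      hπ.contMDiff.contMDiffAt.comp (a, (b : G ⧸ H))
        (contMDiffAt_fst.mul (hs.comp (a, (b : G ⧸ H)) contMDiffAt_snd))
    refine h1.congr_of_eventuallyEq ?_
    filter_upwards [(continuous_snd.tendsto (a, (b : G ⧸ H))).eventually hfs] with q hq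
    change q.1 • q.2 = q.1 • ((s q.2 : G) : G ⧸ H)
    rw [hq]

variable (hπ : IsSubmersion 𝓘(ℝ, E) 𝓘(ℝ, B) ∞ (fun a : G ↦ (a : G ⧸ H)))
include hπ

theorem projDeriv_surjective : Function.Surjective (projDeriv E B H) :=
  (hπ.isSubmersionAt 1).mfderiv_surjective

/-- A vector killed by dπ is the velocity of a curve in the fibre H, and this curve is smooth into H
because H is embedded. Conversely π is constant on H. -/
theorem projDeriv_eq_zero_iff [ChartedSpace F H] [LieGroup 𝓘(ℝ, F) ∞ H]
    (hι : IsSmoothEmbedding 𝓘(ℝ, F) 𝓘(ℝ, E) ∞ (Subtype.val : H → G))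
    (X : GroupLieAlgebra 𝓘(ℝ, E) G) :
    projDeriv E B H X = 0 ↔ X ∈ subgroupLieAlgebra E F H := by
  have hval : MDifferentiableAt 𝓘(ℝ, F) 𝓘(ℝ, E) (Subtype.val : H → G) 1 :=
    hι.contMDiff.mdifferentiableAt (by simp)
  constructor
  · intro hX
    obtain ⟨γ, hγ, hγ0, hγX, hγH⟩ := (hπ.isSubmersionAt 1).exists_curve X hX
    have hmem : ∀ᶠ t in 𝓝 0, γ t ∈ H := by
      filter_upwards [hγH] with t ht
      have h1 : ((1 : G) : G ⧸ H) = (γ t : G ⧸ H) := ht.symm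
      rw [QuotientGroup.eq] at h1
      simpa using h1
    classical
    let δ : ℝ → H := fun t ↦ if h : γ t ∈ H then ⟨γ t, h⟩ else 1
    have hδγ : Subtype.val ∘ δ =ᶠ[𝓝 0] γ := by
      filter_upwards [hmem] with t ht
      simp [δ, ht]
    have hδ0 : δ 0 = 1 := by
      apply Subtype.ext
      exact hδγ.eq_of_nhds.trans hγ0
    have hδ : ContMDiffAt 𝓘(ℝ, ℝ) 𝓘(ℝ, F) ∞ δ 0 := by
      refine (ContMDiffAt.iff_comp_isImmersionAt (hι.isImmersion.isImmersionAt _)).2 ⟨?_, ?_⟩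
      · rw [hι.isEmbedding.continuousAt_iff]
        exact hγ.continuousAt.congr hδγ.symm
      · exact hγ.congr_of_eventuallyEq hδγ
    have h1 := mfderiv_comp_apply_of_eq (I := 𝓘(ℝ, ℝ)) (I' := 𝓘(ℝ, F)) (I'' := 𝓘(ℝ, E)) (0 : ℝ)
      hval (hδ.mdifferentiableAt (by simp)) hδ0 (1 : ℝ)
    have h2 := hδγ.mfderiv_eq (I := 𝓘(ℝ, ℝ)) (I' := 𝓘(ℝ, E))
    exact ⟨(mfderiv 𝓘(ℝ, ℝ) 𝓘(ℝ, F) δ 0 : ℝ →L[ℝ] F) 1,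
      h1.symm.trans ((congrArg (fun T : ℝ →L[ℝ] E ↦ T 1) h2).trans hγX)⟩
  · rintro ⟨v, rfl⟩
    have h1 := mfderiv_comp_apply (I := 𝓘(ℝ, F)) (I' := 𝓘(ℝ, E)) (I'' := 𝓘(ℝ, B)) (1 : H)
      (hπ.contMDiff.mdifferentiableAt (x := ((1 : H) : G)) (by simp)) hval v
    have h2 : (fun a : G ↦ (a : G ⧸ H)) ∘ (Subtype.val : H → G) = fun _ ↦ basePoint H := by
      ext h
      simp [QuotientGroup.eq]
    rw [h2, mfderiv_const] at h1
    exact h1.symm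

end Quotient

/-! ### Tensoriality of the covariant derivative of a tensor field. -/

section TensorCalculus

variable {B : Type*} [NormedAddCommGroup B] [NormedSpace ℝ B] [FiniteDimensional ℝ B]
  {M : Type*} [TopologicalSpace M] [ChartedSpace B M] [IsManifold 𝓘(ℝ, B) ∞ M]

/-- A Riemannian metric as a symmetric tensor field. -/
def SmoothMetric.toTensor (g : SmoothMetric B M) : SymmTensorField B M where
  form := g.inner
  symm := g.symm
  contMDiff := g.contMDiff

namespace SymmTensorField

variable (A : SymmTensorField B M) (D : AffineConnection B M)

theorem mdifferentiableAt_form {Y Z : Π p : M, TangentSpace 𝓘(ℝ, B) p} {p : M}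
    (hY : MDiffAt (T% Y) p) (hZ : MDiffAt (T% Z) p) :
    MDiffAt (fun q ↦ A.form q (Y q) (Z q)) p := by
  have h := MDifferentiableAt.clm_bundle_apply₂ (F₁ := B) (F₂ := B) (F₃ := ℝ) (E₃ := Trivial M ℝ)
    (b := fun q : M ↦ q) (A.contMDiff.mdifferentiableAt (x := p) (by simp)) hY hZ
  rw [mdifferentiableAt_totalSpace] at h
  exact h.2

/-- The value of `(∇_v A)(Y, Z)` at `p`. -/
def covDerivAt (Y Z : Π p : M, TangentSpace 𝓘(ℝ, B) p) (p : M) (v : TangentSpace 𝓘(ℝ, B) p) : ℝ :=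
  mvfderiv 𝓘(ℝ, B) (fun q : M ↦ A.form q (Y q) (Z q)) p v
    - A.form p (D Y p v) (Z p) - A.form p (Y p) (D Z p v)

variable {A D} {p : M} (v : TangentSpace 𝓘(ℝ, B) p)

theorem tensorialAt_covDerivAt_left {Z : Π p : M, TangentSpace 𝓘(ℝ, B) p}
    (hZ : MDiffAt (T% Z) p) :
    TensorialAt 𝓘(ℝ, B) B (fun Y ↦ A.covDerivAt D Y Z p v) p where
  smul hf hY := by
    simp [covDerivAt, mvfderiv_fun_mul hf (A.mdifferentiableAt_form hY hZ),
      D.isCovariantDerivativeOn.leibniz hY hf]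
    ring
  add hY hY' := by
    simp [covDerivAt, mvfderiv_fun_add (A.mdifferentiableAt_form hY hZ)
      (A.mdifferentiableAt_form hY' hZ), D.isCovariantDerivativeOn.add hY hY']
    ring

theorem tensorialAt_covDerivAt_right {Y : Π p : M, TangentSpace 𝓘(ℝ, B) p}
    (hY : MDiffAt (T% Y) p) :
    TensorialAt 𝓘(ℝ, B) B (fun Z ↦ A.covDerivAt D Y Z p v) p where
  smul hf hZ := by
    simp [covDerivAt, mvfderiv_fun_mul hf (A.mdifferentiableAt_form hY hZ),
      D.isCovariantDerivativeOn.leibniz hZ hf]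
    ring
  add hZ hZ' := by
    simp [covDerivAt, mvfderiv_fun_add (A.mdifferentiableAt_form hY hZ)
      (A.mdifferentiableAt_form hY hZ'), D.isCovariantDerivativeOn.add hZ hZ']
    ring

/-- By tensoriality in Y and Z, arbitrary fields may be replaced by action fields with the same
values at p. -/
theorem covDerivAt_congr {Y Y' Z Z' : Π p : M, TangentSpace 𝓘(ℝ, B) p}
    (hY : MDiffAt (T% Y) p) (hY' : MDiffAt (T% Y') p) (hZ : MDiffAt (T% Z) p)
    (hZ' : MDiffAt (T% Z') p) (hYY : Y p = Y' p) (hZZ : Z p = Z' p) :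
    A.covDerivAt D Y Z p v = A.covDerivAt D Y' Z' p v :=
  TensorialAt.pointwise₂ (I := 𝓘(ℝ, B)) (F := B) (F' := B)
    (Φ := fun Y Z ↦ A.covDerivAt D Y Z p v)
    (fun _ h ↦ tensorialAt_covDerivAt_left v h) (fun _ h ↦ tensorialAt_covDerivAt_right v h)
    hY hY' hZ hZ' hYY hZZ

end SymmTensorField

end TensorCalculus

/-! ### Invariant tensor fields along action fields. -/

section InvariantTensors

variable {E : Type*} [NormedAddCommGroup E] [NormedSpace ℝ E] [FiniteDimensional ℝ E]
  {B : Type*} [NormedAddCommGroup B] [NormedSpace ℝ B] [FiniteDimensional ℝ B]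
  {G : Type*} [Group G] [TopologicalSpace G] [ChartedSpace E G] [LieGroup 𝓘(ℝ, E) ∞ G]
  {H : Subgroup G} [ChartedSpace B (G ⧸ H)] [IsManifold 𝓘(ℝ, B) ∞ (G ⧸ H)]
  [ContMDiffSMul 𝓘(ℝ, E) 𝓘(ℝ, B) ∞ G (G ⧸ H)]

omit [FiniteDimensional ℝ E] [FiniteDimensional ℝ B] [IsManifold 𝓘(ℝ, B) ∞ (G ⧸ H)]
  [LieGroup 𝓘(ℝ, E) ∞ G] [ContMDiffSMul 𝓘(ℝ, E) 𝓘(ℝ, B) ∞ G (G ⧸ H)] in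
theorem fundamentalField_basePoint (X : GroupLieAlgebra 𝓘(ℝ, E) G) :
    fundamentalField B X (basePoint H) = projDeriv E B H X := by
  have : (fun a : G ↦ a • basePoint H) = fun a : G ↦ (a : G ⧸ H) := by
    ext a
    exact congrArg QuotientGroup.mk (mul_one a)
  unfold fundamentalField projDeriv
  rw [this]
  rfl

omit [FiniteDimensional ℝ E] [FiniteDimensional ℝ B] [IsManifold 𝓘(ℝ, B) ∞ (G ⧸ H)] in
theorem fundamentalField_smul' (a : G) (p : G ⧸ H) (X : GroupLieAlgebra 𝓘(ℝ, E) G) :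
    fundamentalField B X (a • p)
      = translationDeriv B H a p (fundamentalField B (adjointAction E a⁻¹ X) p) :=
  fundamentalField_smul a p X

omit [FiniteDimensional ℝ E] [FiniteDimensional ℝ B] [IsManifold 𝓘(ℝ, B) ∞ (G ⧸ H)]
  [LieGroup 𝓘(ℝ, E) ∞ G] [ContMDiffSMul 𝓘(ℝ, E) 𝓘(ℝ, B) ∞ G (G ⧸ H)] in
-- The chain rule. The two sides lie over (ab)p and a(bp), which are not definitionally equal, so
-- they are compared in the model space B.
theorem translationDeriv_mul (hs : ContMDiffSMul 𝓘(ℝ, E) 𝓘(ℝ, B) ∞ G (G ⧸ H))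
    (a b : G) (p : G ⧸ H) (u : TangentSpace 𝓘(ℝ, B) p) :
    (translationDeriv B H (a * b) p u : B)
      = translationDeriv B H a (b • p) (translationDeriv B H b p u) := by
  have h : (fun q : G ⧸ H ↦ (a * b) • q) = (fun q : G ⧸ H ↦ a • q) ∘ (fun q : G ⧸ H ↦ b • q) := by
    ext q; simp [mul_smul]
  have hd : ∀ (a : G) (q : G ⧸ H), MDifferentiableAt 𝓘(ℝ, B) 𝓘(ℝ, B) (fun q : G ⧸ H ↦ a • q) q :=
    fun a q ↦ (contMDiff_translation (E := E) a).mdifferentiableAt (by simp)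
  unfold translationDeriv
  rw [h]
  exact mfderiv_comp_apply_of_eq p (hd _ _) (hd _ _) rfl u

omit [FiniteDimensional ℝ E] [FiniteDimensional ℝ B] [IsManifold 𝓘(ℝ, B) ∞ (G ⧸ H)]
  [LieGroup 𝓘(ℝ, E) ∞ G] [ContMDiffSMul 𝓘(ℝ, E) 𝓘(ℝ, B) ∞ G (G ⧸ H)] in
theorem translationDeriv_one (p : G ⧸ H) (u : TangentSpace 𝓘(ℝ, B) p) :
    (translationDeriv B H 1 p u : B) = u := by
  have h : (fun q : G ⧸ H ↦ (1 : G) • q) = id := by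
    ext q; simp
  unfold translationDeriv
  rw [h, mfderiv_id]
  rfl

omit [FiniteDimensional ℝ E] [FiniteDimensional ℝ B] [IsManifold 𝓘(ℝ, B) ∞ (G ⧸ H)]
  [LieGroup 𝓘(ℝ, E) ∞ G] [ContMDiffSMul 𝓘(ℝ, E) 𝓘(ℝ, B) ∞ G (G ⧸ H)] in
theorem translationDeriv_surjective (hs : ContMDiffSMul 𝓘(ℝ, E) 𝓘(ℝ, B) ∞ G (G ⧸ H))
    (a : G) (p : G ⧸ H) :
    Function.Surjective (translationDeriv B H a p) := by
  intro u
  have h1 := translationDeriv_mul hs a a⁻¹ (a • p) u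
  have h2 := translationDeriv_one (a • p) u
  refine ⟨(translationDeriv B H a⁻¹ (a • p) u : B), ?_⟩
  rw [mul_inv_cancel] at h1
  have h3 : (translationDeriv B H a (a⁻¹ • a • p) (translationDeriv B H a⁻¹ (a • p) u) : B)
      = (translationDeriv B H a p : B →L[ℝ] B) (translationDeriv B H a⁻¹ (a • p) u : B) :=
    congrArg (fun q : G ⧸ H ↦ (translationDeriv B H a q : B →L[ℝ] B)
      (translationDeriv B H a⁻¹ (a • p) u : B)) (inv_smul_smul a p)
  exact h3.symm.trans (h1.symm.trans h2)

omit [FiniteDimensional ℝ B] in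
-- True at eH because π is a submersion, and transported to other points by
-- `fundamentalField_smul'`.
theorem fundamentalField_surjective
    (hπ : IsSubmersion 𝓘(ℝ, E) 𝓘(ℝ, B) ∞ (fun a : G ↦ (a : G ⧸ H))) (p : G ⧸ H) :
    Function.Surjective (fun X : GroupLieAlgebra 𝓘(ℝ, E) G ↦ fundamentalField B X p) := by
  obtain ⟨a, rfl⟩ := QuotientGroup.mk_surjective p
  have ha : (a : G ⧸ H) = a • basePoint H := congrArg QuotientGroup.mk (mul_one a).symm
  rw [ha]
  intro u
  obtain ⟨w, rfl⟩ := translationDeriv_surjective (E := E) inferInstance a (basePoint H) u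
  obtain ⟨X, rfl⟩ := projDeriv_surjective hπ w
  refine ⟨adjointAction E a X, ?_⟩
  change fundamentalField B (adjointAction E a X) (a • basePoint H) = _
  rw [fundamentalField_smul', adjointAction_inv_apply, fundamentalField_basePoint]

omit [FiniteDimensional ℝ B] [IsManifold 𝓘(ℝ, B) ∞ (G ⧸ H)] in
variable (B H) in
theorem projDeriv_adjointAction {h : G} (hh : h ∈ H) (X : GroupLieAlgebra 𝓘(ℝ, E) G) :
    (projDeriv E B H (adjointAction E h X) : B)
      = translationDeriv B H h (basePoint H) (projDeriv E B H X) := by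
  have h1 := fundamentalField_smul' (B := B) h (basePoint H) (adjointAction E h X)
  rw [adjointAction_inv_apply, fundamentalField_basePoint] at h1
  have h2 : h • basePoint H = basePoint H := by
    refine (QuotientGroup.eq (s := H)).2 ?_
    simpa using hh
  have h3 : (fundamentalField B (adjointAction E h X) (h • basePoint H) : B)
      = fundamentalField B (adjointAction E h X) (basePoint H) :=
    congrArg (fun q : G ⧸ H ↦ (fundamentalField B (adjointAction E h X) q : B)) h2
  rw [fundamentalField_basePoint] at h3
  exact h3.symm.trans h1

namespace SymmTensorField

variable {A : SymmTensorField B (G ⧸ H)} {D : AffineConnection B (G ⧸ H)}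

omit [IsManifold 𝓘(ℝ, B) ∞ (G ⧸ H)] [FiniteDimensional ℝ B] in
theorem _root_.eq_of_base_eq {Φ : G ⧸ H → B →L[ℝ] B →L[ℝ] ℝ} {p q : G ⧸ H} (h : p = q)
    (u v : B) : Φ p u v = Φ q u v := by rw [h]

theorem IsInvariant.atBase_adjointAction (hA : A.IsInvariant) {h : G} (hh : h ∈ H)
    (X Y : GroupLieAlgebra 𝓘(ℝ, E) G) :
    A.atBase E (adjointAction E h X) (adjointAction E h Y) = A.atBase E X Y := by
  have h2 : h • basePoint H = basePoint H := by
    refine (QuotientGroup.eq (s := H)).2 ?_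
    simpa using hh
  have h1 := hA h (basePoint H) (projDeriv E B H X) (projDeriv E B H Y)
  have h3 := eq_of_base_eq (Φ := A.form) h2
    (translationDeriv B H h (basePoint H) (projDeriv E B H X))
    (translationDeriv B H h (basePoint H) (projDeriv E B H Y))
  refine Eq.trans ?_ (h3.symm.trans h1)
  exact congrArg₂ (fun u v : B ↦ (A.form (basePoint H) : B →L[ℝ] B →L[ℝ] ℝ) u v)
    (projDeriv_adjointAction B H hh X) (projDeriv_adjointAction B H hh Y)

theorem IsInvariant.form_fundamentalField_smul (hA : A.IsInvariant) (a : G) (p : G ⧸ H)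
    (X Y : GroupLieAlgebra 𝓘(ℝ, E) G) :
    A.form (a • p) (fundamentalField B X (a • p)) (fundamentalField B Y (a • p))
      = A.form p (fundamentalField B (adjointAction E a⁻¹ X) p)
        (fundamentalField B (adjointAction E a⁻¹ Y) p) := by
  rw [fundamentalField_smul', fundamentalField_smul', hA]

/-- Along the orbit map b ↦ b • p the function is A_p evaluated on the fields of Ad(b⁻¹) Y and
Ad(b⁻¹) Z, by invariance. The product rule and the derivative of Ad(b⁻¹) at 1 finish. -/
theorem IsInvariant.mvfderiv_form_fundamentalField (hA : A.IsInvariant) (p : G ⧸ H)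
    (X Y Z : GroupLieAlgebra 𝓘(ℝ, E) G) :
    mvfderiv 𝓘(ℝ, B)
        (fun q : G ⧸ H ↦ A.form q (fundamentalField B Y q) (fundamentalField B Z q)) p
        (fundamentalField B X p)
      = -A.form p (fundamentalField B ⁅X, Y⁆ p) (fundamentalField B Z p)
        - A.form p (fundamentalField B Y p) (fundamentalField B ⁅X, Z⁆ p) := by
  let T : E →L[ℝ] B := mfderiv 𝓘(ℝ, E) 𝓘(ℝ, B) (fun a : G ↦ a • p) 1
  let α : B →L[ℝ] B →L[ℝ] ℝ := A.form p
  let β : E →L[ℝ] E →L[ℝ] ℝ := α.bilinearComp T T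
  let f : G ⧸ H → ℝ := fun q ↦ A.form q (fundamentalField B Y q) (fundamentalField B Z q)
  have hf : MDiffAt f p := A.mdifferentiableAt_form (mdifferentiableAt_fundamentalField Y p)
    (mdifferentiableAt_fundamentalField Z p)
  let W : GroupLieAlgebra 𝓘(ℝ, E) G → G → E := fun Y b ↦ adjointAction E b⁻¹ Y
  have hW : ∀ Y, HasMFDerivAt 𝓘(ℝ, E) 𝓘(ℝ, E) (W Y) (1 : G)
      (mfderiv 𝓘(ℝ, E) 𝓘(ℝ, E) (W Y) 1) :=
    fun Y ↦ (mdifferentiableAt_adjointAction_inv_apply Y 1).hasMFDerivAt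
  have hW1 : ∀ Y, W Y 1 = Y := fun Y ↦ by
    simp only [W, inv_one]
    exact adjointAction_one Y
  have e : f ∘ (fun a : G ↦ a • p) = (fun w : E × E ↦ β w.1 w.2) ∘ fun b ↦ (W Y b, W Z b) := by
    ext b
    exact hA.form_fundamentalField_smul b p Y Z
  have h1 := mfderiv_comp_apply_of_eq (I := 𝓘(ℝ, E)) (I' := 𝓘(ℝ, B)) (I'' := 𝓘(ℝ, ℝ)) (g := f)
    (1 : G) hf ((contMDiff_orbitMap p).mdifferentiableAt (by simp)) (one_smul G p) X
  have h2 := HasMFDerivAt.comp (1 : G) (f := fun b ↦ (W Y b, W Z b))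
    (β.hasFDerivAt_of_bilinear (hasFDerivAt_fst (𝕜 := ℝ) (p := (W Y 1, W Z 1)))
    (hasFDerivAt_snd (𝕜 := ℝ) (p := (W Y 1, W Z 1)))).hasMFDerivAt
    ⟨(hW Y).1.prodMk (hW Z).1, (hW Y).2.prodMk (hW Z).2⟩
  rw [e, h2.mfderiv] at h1
  refine h1.symm.trans ?_
  have e1 : mfderiv 𝓘(ℝ, E) 𝓘(ℝ, E) (W Y) 1 X = (-⁅X, Y⁆ : GroupLieAlgebra 𝓘(ℝ, E) G) :=
    mfderiv_adjointAction_inv X Y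
  have e2 : mfderiv 𝓘(ℝ, E) 𝓘(ℝ, E) (W Z) 1 X = (-⁅X, Z⁆ : GroupLieAlgebra 𝓘(ℝ, E) G) :=
    mfderiv_adjointAction_inv X Z
  have e3 : β (W Y 1) (mfderiv 𝓘(ℝ, E) 𝓘(ℝ, E) (W Z) 1 X)
      + β (mfderiv 𝓘(ℝ, E) 𝓘(ℝ, E) (W Y) 1 X) (W Z 1)
      = -β (⁅X, Y⁆ : GroupLieAlgebra 𝓘(ℝ, E) G) Z - β Y (⁅X, Z⁆ : GroupLieAlgebra 𝓘(ℝ, E) G) := by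
    have e4 : ∀ U V : E, β U (-V) = -β U V := fun U V ↦ map_neg (β U) V
    have e5 : ∀ U V : E, β (-U) V = -β U V := fun U V ↦ by rw [map_neg]; rfl
    have e6 : β (W Y 1) (mfderiv 𝓘(ℝ, E) 𝓘(ℝ, E) (W Z) 1 X)
        = -β Y (⁅X, Z⁆ : GroupLieAlgebra 𝓘(ℝ, E) G) :=
      (congrArg₂ (fun U V : E ↦ β U V) (hW1 Y) e2).trans (e4 _ _)
    have e7 : β (mfderiv 𝓘(ℝ, E) 𝓘(ℝ, E) (W Y) 1 X) (W Z 1)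
        = -β (⁅X, Y⁆ : GroupLieAlgebra 𝓘(ℝ, E) G) Z :=
      (congrArg₂ (fun U V : E ↦ β U V) e1 (hW1 Z)).trans (e5 _ _)
    rw [e6, e7]
    ring
  exact e3

end SymmTensorField

end InvariantTensors

/-! ### The Levi-Civita connection on action fields and reduction to the base point. -/

section LeviCivita

variable {E : Type*} [NormedAddCommGroup E] [NormedSpace ℝ E] [FiniteDimensional ℝ E]
  {B : Type*} [NormedAddCommGroup B] [NormedSpace ℝ B] [FiniteDimensional ℝ B]
  {G : Type*} [Group G] [TopologicalSpace G] [ChartedSpace E G] [LieGroup 𝓘(ℝ, E) ∞ G]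
  {H : Subgroup G} [ChartedSpace B (G ⧸ H)] [IsManifold 𝓘(ℝ, B) ∞ (G ⧸ H)]
  [ContMDiffSMul 𝓘(ℝ, E) 𝓘(ℝ, B) ∞ G (G ⧸ H)]
  {g : SmoothMetric B (G ⧸ H)} {D : AffineConnection B (G ⧸ H)}
  {A : SymmTensorField B (G ⧸ H)}

namespace AffineConnection.IsLeviCivita

theorem apply_fundamentalField (hD : D.IsLeviCivita g) (X Y : GroupLieAlgebra 𝓘(ℝ, E) G)
    (p : G ⧸ H) :
    D (fun q ↦ fundamentalField B Y q) p (fundamentalField B X p)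
      = D (fun q ↦ fundamentalField B X q) p (fundamentalField B Y p)
        - fundamentalField B ⁅X, Y⁆ p := by
  have := FiniteDimensional.complete ℝ B
  have h := (CovariantDerivative.torsion_eq_zero_iff D).1 hD.1
    (mdifferentiableAt_fundamentalField (B := B) X p) (mdifferentiableAt_fundamentalField Y p)
  rw [mlieBracket_fundamentalField] at h
  rw [sub_eq_iff_eq_add.1 h]
  abel

/-- For an invariant tensor field `A`, the form `(∇_{X^#} A)(Y^#, Z^#)` only involves the
derivatives of the field `X^#`. -/
theorem covDerivAt_fundamentalField (hD : D.IsLeviCivita g) (hA : A.IsInvariant)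
    (X Y Z : GroupLieAlgebra 𝓘(ℝ, E) G) (p : G ⧸ H) :
    A.covDerivAt D (fun q ↦ fundamentalField B Y q) (fun q ↦ fundamentalField B Z q) p
        (fundamentalField B X p)
      = -A.form p (D (fun q ↦ fundamentalField B X q) p (fundamentalField B Y p))
          (fundamentalField B Z p)
        - A.form p (fundamentalField B Y p)
          (D (fun q ↦ fundamentalField B X q) p (fundamentalField B Z p)) := by
  unfold SymmTensorField.covDerivAt
  rw [hA.mvfderiv_form_fundamentalField, hD.apply_fundamentalField X Y,
    hD.apply_fundamentalField X Z]
  simp only [map_sub, sub_apply]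
  ring

variable (hD : D.IsLeviCivita g) (hg : g.IsInvariant)
include hD hg

/-- The action fields of an invariant metric are Killing fields. -/
theorem inner_fundamentalField_skew (X Y Z : GroupLieAlgebra 𝓘(ℝ, E) G) (p : G ⧸ H) :
    g.inner p (fundamentalField B Y p)
        (D (fun q ↦ fundamentalField B X q) p (fundamentalField B Z p))
      = -g.inner p (D (fun q ↦ fundamentalField B X q) p (fundamentalField B Y p))
          (fundamentalField B Z p) := by
  have h1 := hD.covDerivAt_fundamentalField (A := g.toTensor) hg X Y Z p
  have h2 := hD.2 (fun q ↦ fundamentalField B Y q) (fun q ↦ fundamentalField B Z q) p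
    (mdifferentiableAt_fundamentalField Y p) (mdifferentiableAt_fundamentalField Z p)
    (fundamentalField B X p)
  have h3 : g.toTensor.covDerivAt D (fun q ↦ fundamentalField B Y q)
      (fun q ↦ fundamentalField B Z q) p (fundamentalField B X p) = 0 := by
    unfold SymmTensorField.covDerivAt
    exact (congrArg (fun t : ℝ ↦ t - _ - _) h2).trans (by simp [SmoothMetric.toTensor])
  rw [h3] at h1
  simp only [SmoothMetric.toTensor] at h1
  linarith

/-- Skewness turns the second term into -⟨∇_{X^#} Y^#, Z^#⟩, and vanishing torsion identifies the
difference with [X, Y]^#. -/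
theorem inner_fundamentalField_add (X Y Z : GroupLieAlgebra 𝓘(ℝ, E) G) (p : G ⧸ H) :
    g.inner p (D (fun q ↦ fundamentalField B X q) p (fundamentalField B Y p))
        (fundamentalField B Z p)
      + g.inner p (D (fun q ↦ fundamentalField B Y q) p (fundamentalField B Z p))
        (fundamentalField B X p)
      = g.inner p (fundamentalField B ⁅X, Y⁆ p) (fundamentalField B Z p) := by
  have h1 := hD.inner_fundamentalField_skew hg Y Z X p
  rw [g.symm, hD.apply_fundamentalField X Y] at h1
  simp only [map_sub, sub_apply] at h1
  linarith

theorem inner_fundamentalField_smul (a : G) (p : G ⧸ H) (X Y Z : GroupLieAlgebra 𝓘(ℝ, E) G) :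
    g.inner (a • p) (D (fun q ↦ fundamentalField B X q) (a • p) (fundamentalField B Y (a • p)))
        (fundamentalField B Z (a • p))
      = g.inner p (D (fun q ↦ fundamentalField B (adjointAction E a⁻¹ X) q) p
          (fundamentalField B (adjointAction E a⁻¹ Y) p))
        (fundamentalField B (adjointAction E a⁻¹ Z) p) := by
  have key : ∀ X Y Z : GroupLieAlgebra 𝓘(ℝ, E) G,
      g.inner (a • p) (fundamentalField B ⁅X, Y⁆ (a • p)) (fundamentalField B Z (a • p))
        = g.inner p (fundamentalField B ⁅adjointAction E a⁻¹ X, adjointAction E a⁻¹ Y⁆ p)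
          (fundamentalField B (adjointAction E a⁻¹ Z) p) := by
    intro X Y Z
    rw [← adjointAction_lie]
    exact SymmTensorField.IsInvariant.form_fundamentalField_smul (A := g.toTensor) hg a p _ _
  -- The sums a + b, b + c, c + a determine a, b and c. Here they are invariant, so each summand is;
  -- this plays the role of the Koszul formula.
  have h1 := hD.inner_fundamentalField_add hg X Y Z (a • p)
  have h2 := hD.inner_fundamentalField_add hg Y Z X (a • p)
  have h3 := hD.inner_fundamentalField_add hg Z X Y (a • p)
  rw [key] at h1 h2 h3
  rw [← hD.inner_fundamentalField_add hg] at h1 h2 h3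
  linarith

theorem apply_fundamentalField_smul
    (hπ : IsSubmersion 𝓘(ℝ, E) 𝓘(ℝ, B) ∞ (fun a : G ↦ (a : G ⧸ H))) (a : G) (p : G ⧸ H)
    (X Y : GroupLieAlgebra 𝓘(ℝ, E) G) :
    D (fun q ↦ fundamentalField B X q) (a • p) (fundamentalField B Y (a • p))
      = translationDeriv B H a p (D (fun q ↦ fundamentalField B (adjointAction E a⁻¹ X) q) p
          (fundamentalField B (adjointAction E a⁻¹ Y) p)) := by
  rw [← sub_eq_zero]
  by_contra hne
  refine (g.pos _ _ hne).ne' ?_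
  -- Pair the difference of the two sides with itself, writing one copy as the value of an action
  -- field.
  obtain ⟨Z, hZ⟩ := fundamentalField_surjective hπ (a • p)
    (D (fun q ↦ fundamentalField B X q) (a • p) (fundamentalField B Y (a • p))
      - translationDeriv B H a p (D (fun q ↦ fundamentalField B (adjointAction E a⁻¹ X) q) p
          (fundamentalField B (adjointAction E a⁻¹ Y) p)))
  have h1 := hD.inner_fundamentalField_smul hg a p X Y Z
  rw [← hg a p, ← fundamentalField_smul'] at h1
  nth_rewrite 2 [← hZ]
  simp only [map_sub, sub_apply]
  exact sub_eq_zero.2 h1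

theorem covDerivAt_fundamentalField_smul
    (hπ : IsSubmersion 𝓘(ℝ, E) 𝓘(ℝ, B) ∞ (fun a : G ↦ (a : G ⧸ H))) (hA : A.IsInvariant) (a : G)
    (p : G ⧸ H) (X Y Z : GroupLieAlgebra 𝓘(ℝ, E) G) :
    A.covDerivAt D (fun q ↦ fundamentalField B Y q) (fun q ↦ fundamentalField B Z q) (a • p)
        (fundamentalField B X (a • p))
      = A.covDerivAt D (fun q ↦ fundamentalField B (adjointAction E a⁻¹ Y) q)
        (fun q ↦ fundamentalField B (adjointAction E a⁻¹ Z) q) p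
        (fundamentalField B (adjointAction E a⁻¹ X) p) := by
  rw [hD.covDerivAt_fundamentalField hA, hD.covDerivAt_fundamentalField hA,
    hD.apply_fundamentalField_smul hg hπ, hD.apply_fundamentalField_smul hg hπ,
    fundamentalField_smul', fundamentalField_smul', hA, hA]

omit hD hg in
variable (B H) in
/-- The fundamental field of the action on `G ⧸ H` as a smooth vector field. -/
def _root_.smoothFundamentalField (X : GroupLieAlgebra 𝓘(ℝ, E) G) :
    SmoothVectorField B (G ⧸ H) :=
  ⟨fun p ↦ fundamentalField B X p, contMDiff_fundamentalField X⟩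

omit hD hg in
theorem _root_.SymmTensorField.covDeriv_eq_covDerivAt_fundamentalField
    (A : SymmTensorField B (G ⧸ H)) (D : AffineConnection B (G ⧸ H))
    {X Y Z : SmoothVectorField B (G ⧸ H)} {p : G ⧸ H} {X' Y' Z' : GroupLieAlgebra 𝓘(ℝ, E) G}
    (hX : fundamentalField B X' p = X p) (hY : fundamentalField B Y' p = Y p)
    (hZ : fundamentalField B Z' p = Z p) :
    A.covDeriv D X Y Z p = A.covDerivAt D (fun q ↦ fundamentalField B Y' q)
      (fun q ↦ fundamentalField B Z' q) p (fundamentalField B X' p) := by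
  rw [hX]
  exact SymmTensorField.covDerivAt_congr _ (Y.contMDiff.mdifferentiableAt (by simp))
    (mdifferentiableAt_fundamentalField _ _) (Z.contMDiff.mdifferentiableAt (by simp))
    (mdifferentiableAt_fundamentalField _ _) hY.symm hZ.symm

/-- Tensoriality reduces to action fields, and equivariance of ∇A moves the point to eH. -/
theorem isCodazzi_iff (hπ : IsSubmersion 𝓘(ℝ, E) 𝓘(ℝ, B) ∞ (fun a : G ↦ (a : G ⧸ H)))
    (hA : A.IsInvariant) :
    A.IsCodazzi D ↔ ∀ X Y Z : GroupLieAlgebra 𝓘(ℝ, E) G,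
      A.covDerivAt D (fun q ↦ fundamentalField B Y q) (fun q ↦ fundamentalField B Z q)
        (basePoint H) (fundamentalField B X (basePoint H))
      = A.covDerivAt D (fun q ↦ fundamentalField B X q) (fun q ↦ fundamentalField B Z q)
        (basePoint H) (fundamentalField B Y (basePoint H)) := by
  constructor
  · intro h X Y Z
    exact h (smoothFundamentalField B H X) (smoothFundamentalField B H Y)
      (smoothFundamentalField B H Z) (basePoint H)
  · intro h X Y Z p
    obtain ⟨X', hX⟩ := fundamentalField_surjective (E := E) hπ p (X p)
    obtain ⟨Y', hY⟩ := fundamentalField_surjective (E := E) hπ p (Y p)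
    obtain ⟨Z', hZ⟩ := fundamentalField_surjective (E := E) hπ p (Z p)
    rw [A.covDeriv_eq_covDerivAt_fundamentalField D hX hY hZ,
      A.covDeriv_eq_covDerivAt_fundamentalField D hY hX hZ]
    obtain ⟨a, rfl⟩ := QuotientGroup.mk_surjective p
    have ha : (a : G ⧸ H) = a • basePoint H := congrArg QuotientGroup.mk (mul_one a).symm
    rw [ha, hD.covDerivAt_fundamentalField_smul hg hπ hA,
      hD.covDerivAt_fundamentalField_smul hg hπ hA, h]

theorem isParallel_iff (hπ : IsSubmersion 𝓘(ℝ, E) 𝓘(ℝ, B) ∞ (fun a : G ↦ (a : G ⧸ H)))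
    (hA : A.IsInvariant) :
    A.IsParallel D ↔ ∀ X Y Z : GroupLieAlgebra 𝓘(ℝ, E) G,
      A.covDerivAt D (fun q ↦ fundamentalField B Y q) (fun q ↦ fundamentalField B Z q)
        (basePoint H) (fundamentalField B X (basePoint H)) = 0 := by
  constructor
  · intro h X Y Z
    exact h (smoothFundamentalField B H X) (smoothFundamentalField B H Y)
      (smoothFundamentalField B H Z) (basePoint H)
  · intro h X Y Z p
    obtain ⟨X', hX⟩ := fundamentalField_surjective (E := E) hπ p (X p)
    obtain ⟨Y', hY⟩ := fundamentalField_surjective (E := E) hπ p (Y p)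
    obtain ⟨Z', hZ⟩ := fundamentalField_surjective (E := E) hπ p (Z p)
    rw [A.covDeriv_eq_covDerivAt_fundamentalField D hX hY hZ]
    obtain ⟨a, rfl⟩ := QuotientGroup.mk_surjective p
    have ha : (a : G ⧸ H) = a • basePoint H := congrArg QuotientGroup.mk (mul_one a).symm
    rw [ha, hD.covDerivAt_fundamentalField_smul hg hπ hA, h]

end AffineConnection.IsLeviCivita

end LeviCivita

/-! ### The Codazzi equation as algebra on 𝔪. -/

section Core

variable {E : Type*} [NormedAddCommGroup E] [NormedSpace ℝ E] [FiniteDimensional ℝ E]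
  {F : Type*} [NormedAddCommGroup F] [NormedSpace ℝ F]
  {B : Type*} [NormedAddCommGroup B] [NormedSpace ℝ B] [FiniteDimensional ℝ B]
  {G : Type*} [Group G] [TopologicalSpace G] [ChartedSpace E G] [LieGroup 𝓘(ℝ, E) ∞ G]
  {H : Subgroup G} [ChartedSpace F H] [LieGroup 𝓘(ℝ, F) ∞ H]
  [ChartedSpace B (G ⧸ H)] [IsManifold 𝓘(ℝ, B) ∞ (G ⧸ H)]
  {P : ReductiveDecomposition E F H}
  {g : SmoothMetric B (G ⧸ H)} {D : AffineConnection B (G ⧸ H)}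
  {A : SymmTensorField B (G ⧸ H)} {r : ℕ}
  {V : Fin r → Submodule ℝ (GroupLieAlgebra 𝓘(ℝ, E) G)} {lam : Fin r → ℝ}

namespace ReductiveDecomposition

variable (hπ : IsSubmersion 𝓘(ℝ, E) 𝓘(ℝ, B) ∞ (fun a : G ↦ (a : G ⧸ H)))
  (hι : IsSmoothEmbedding 𝓘(ℝ, F) 𝓘(ℝ, E) ∞ (Subtype.val : H → G))
include hπ hι

theorem projDeriv_bracket (P : ReductiveDecomposition E F H) (X Y : GroupLieAlgebra 𝓘(ℝ, E) G) :
    projDeriv E B H (P.bracket X Y) = projDeriv E B H ⁅X, Y⁆ := by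
  have h : ⁅X, Y⁆ - P.bracket X Y ∈ subgroupLieAlgebra E F H := by
    have h1 := Submodule.projection_add_projection_eq_self P.isCompl.symm ⁅X, Y⁆
    have h2 : ⁅X, Y⁆ - P.bracket X Y
        = (subgroupLieAlgebra E F H).projection P.compl P.isCompl ⁅X, Y⁆ := by
      unfold bracket
      rw [sub_eq_iff_eq_add, add_comm]
      exact h1.symm
    rw [h2]
    exact Submodule.projection_apply_mem _ _
  have h1 := (projDeriv_eq_zero_iff hπ hι _).2 h
  rw [map_sub, sub_eq_zero] at h1
  exact h1.symm

theorem eq_zero_of_projDeriv_eq_zero (P : ReductiveDecomposition E F H)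
    {X : GroupLieAlgebra 𝓘(ℝ, E) G} (hX : X ∈ P.compl) (h : projDeriv E B H X = 0) : X = 0 :=
  Submodule.disjoint_def.1 P.isCompl.disjoint X ((projDeriv_eq_zero_iff hπ hι X).1 h) hX

theorem exists_mem_compl_projDeriv_eq (P : ReductiveDecomposition E F H)
    (u : TangentSpace 𝓘(ℝ, B) (basePoint H)) : ∃ X ∈ P.compl, projDeriv E B H X = u := by
  obtain ⟨X, rfl⟩ := projDeriv_surjective hπ u
  obtain ⟨Y, hY, Z, hZ, rfl⟩ : ∃ Y ∈ subgroupLieAlgebra E F H, ∃ Z ∈ P.compl, Y + Z = X :=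
    Submodule.mem_sup.1 (P.isCompl.sup_eq_top ▸ Submodule.mem_top)
  refine ⟨Z, hZ, ?_⟩
  rw [map_add, (projDeriv_eq_zero_iff hπ hι Y).2 hY, zero_add]

/-- Lift u to 𝔪 and split it along the summands. Pairing with the k-th component, k ≠ i, leaves the
square of its norm, so that component vanishes. -/
theorem IsOrthogonalDecomposition.exists_projDeriv_eq (hV : P.IsOrthogonalDecomposition g V)
    (i : Fin r) (u : TangentSpace 𝓘(ℝ, B) (basePoint H))
    (hu : ∀ k, k ≠ i → ∀ Z ∈ V k, g.inner _ u (projDeriv E B H Z) = 0) :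
    ∃ W ∈ V i, projDeriv E B H W = u := by
  obtain ⟨U, hU, rfl⟩ := P.exists_mem_compl_projDeriv_eq hπ hι u
  rw [← hV.iSup_eq] at hU
  obtain ⟨f, hf, rfl⟩ := (Submodule.mem_iSup_iff_exists_finsupp V U).1 hU
  rw [Finsupp.sum_fintype _ _ (fun _ ↦ rfl)] at hu ⊢
  have h0 : ∀ k, k ≠ i → projDeriv E B H (f k) = 0 := by
    intro k hk
    by_contra hne
    refine (g.pos _ _ hne).ne' ?_
    have h1 := hu k hk (f k) (hf k)
    rw [map_sum, map_sum, sum_apply, Finset.sum_eq_single k] at h1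
    · exact h1
    · exact fun l _ hl ↦ hV.orthogonal l k hl _ (hf l) _ (hf k)
    · exact fun h ↦ absurd (Finset.mem_univ k) h
  refine ⟨f i, hf i, ?_⟩
  rw [map_sum, Finset.sum_eq_single i (fun k _ hk ↦ h0 k hk) (fun h ↦ absurd (Finset.mem_univ i) h)]

omit hπ hι [LieGroup 𝓘(ℝ, F) ∞ H] in
theorem IsOrthogonalDecomposition.le_compl (hV : P.IsOrthogonalDecomposition g V) (i : Fin r) :
    V i ≤ P.compl :=
  hV.iSup_eq ▸ le_iSup V i

end ReductiveDecomposition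

variable [ContMDiffSMul 𝓘(ℝ, E) 𝓘(ℝ, B) ∞ G (G ⧸ H)]

/-- The trilinear form `⟨(∇_{Y^#} X^#)(eH), Z⟩`. -/
def leviCivitaForm (g : SmoothMetric B (G ⧸ H)) (D : AffineConnection B (G ⧸ H))
    (X Y Z : GroupLieAlgebra 𝓘(ℝ, E) G) : ℝ :=
  g.inner (basePoint H) (D (fun q ↦ fundamentalField B X q) (basePoint H) (projDeriv E B H Y))
    (projDeriv E B H Z)

/-- The form `(∇_{X^#} A)(Y^#, Z^#)` at `eH`. -/
def baseCovDeriv (A : SymmTensorField B (G ⧸ H)) (D : AffineConnection B (G ⧸ H))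
    (X Y Z : GroupLieAlgebra 𝓘(ℝ, E) G) : ℝ :=
  A.covDerivAt D (fun q ↦ fundamentalField B Y q) (fun q ↦ fundamentalField B Z q) (basePoint H)
    (fundamentalField B X (basePoint H))

namespace AffineConnection.IsLeviCivita

variable (hD : D.IsLeviCivita g)
include hD

theorem leviCivitaForm_skew (hg : g.IsInvariant) (X Y Z : GroupLieAlgebra 𝓘(ℝ, E) G) :
    leviCivitaForm g D X Z Y = -leviCivitaForm g D X Y Z := by
  have h := hD.inner_fundamentalField_skew hg X Y Z (basePoint H)
  rw [g.symm] at h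
  unfold leviCivitaForm
  simpa only [fundamentalField_basePoint] using h

theorem leviCivitaForm_add (hg : g.IsInvariant) (X Y Z : GroupLieAlgebra 𝓘(ℝ, E) G) :
    leviCivitaForm g D X Y Z + leviCivitaForm g D Y Z X = g.atBase E ⁅X, Y⁆ Z := by
  have h := hD.inner_fundamentalField_add hg X Y Z (basePoint H)
  unfold leviCivitaForm SmoothMetric.atBase
  simpa only [fundamentalField_basePoint] using h

theorem baseCovDeriv_eq (hA : A.IsInvariant) (X Y Z : GroupLieAlgebra 𝓘(ℝ, E) G) :
    baseCovDeriv A D X Y Z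
      = -A.form (basePoint H)
          (D (fun q ↦ fundamentalField B X q) (basePoint H) (projDeriv E B H Y))
          (projDeriv E B H Z)
        - A.form (basePoint H) (projDeriv E B H Y)
          (D (fun q ↦ fundamentalField B X q) (basePoint H) (projDeriv E B H Z)) := by
  have h := hD.covDerivAt_fundamentalField hA X Y Z (basePoint H)
  simp only [fundamentalField_basePoint] at h
  rw [← h, baseCovDeriv, fundamentalField_basePoint]

omit hD in
theorem _root_.baseCovDeriv_add_left (X X' Y Z : GroupLieAlgebra 𝓘(ℝ, E) G) :
    baseCovDeriv A D (X + X') Y Z = baseCovDeriv A D X Y Z + baseCovDeriv A D X' Y Z := by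
  simp only [baseCovDeriv, SymmTensorField.covDerivAt, fundamentalField_add, map_add, add_apply]
  ring

theorem baseCovDeriv_add_middle (hA : A.IsInvariant) (X Y Y' Z : GroupLieAlgebra 𝓘(ℝ, E) G) :
    baseCovDeriv A D X (Y + Y') Z = baseCovDeriv A D X Y Z + baseCovDeriv A D X Y' Z := by
  simp only [hD.baseCovDeriv_eq hA, map_add, add_apply]
  ring

theorem baseCovDeriv_add_right (hA : A.IsInvariant) (X Y Z Z' : GroupLieAlgebra 𝓘(ℝ, E) G) :
    baseCovDeriv A D X Y (Z + Z') = baseCovDeriv A D X Y Z + baseCovDeriv A D X Y Z' := by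
  simp only [hD.baseCovDeriv_eq hA, map_add]
  ring

omit hD in
theorem _root_.baseCovDeriv_congr {X X' Y Y' Z Z' : GroupLieAlgebra 𝓘(ℝ, E) G}
    (hX : projDeriv E B H X = projDeriv E B H X') (hY : projDeriv E B H Y = projDeriv E B H Y')
    (hZ : projDeriv E B H Z = projDeriv E B H Z') :
    baseCovDeriv A D X Y Z = baseCovDeriv A D X' Y' Z' := by
  simp only [← fundamentalField_basePoint] at hX hY hZ
  unfold baseCovDeriv
  rw [hX]
  exact SymmTensorField.covDerivAt_congr _ (mdifferentiableAt_fundamentalField _ _)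
    (mdifferentiableAt_fundamentalField _ _) (mdifferentiableAt_fundamentalField _ _)
    (mdifferentiableAt_fundamentalField _ _) hY hZ

/-- The two terms of ∇A become -λ_k Γ(X, Y, Z) and -λ_j Γ(X, Z, Y), which combine by skewness of Γ.
-/
theorem baseCovDeriv_of_eigen (hg : g.IsInvariant) (hA : A.IsInvariant)
    (hev : ∀ k, ∀ Z ∈ V k, ∀ u, A.form (basePoint H) u (projDeriv E B H Z)
      = lam k * g.inner (basePoint H) u (projDeriv E B H Z))
    {j k : Fin r} (X : GroupLieAlgebra 𝓘(ℝ, E) G) {Y Z : GroupLieAlgebra 𝓘(ℝ, E) G}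
    (hY : Y ∈ V j) (hZ : Z ∈ V k) :
    baseCovDeriv A D X Y Z = (lam j - lam k) * leviCivitaForm g D X Y Z := by
  have h := hD.leviCivitaForm_skew hg X Y Z
  rw [hD.baseCovDeriv_eq hA, hev k Z hZ, A.symm, hev j Y hY]
  unfold leviCivitaForm at h ⊢
  rw [h]
  ring

end AffineConnection.IsLeviCivita

namespace ReductiveDecomposition

variable (hπ : IsSubmersion 𝓘(ℝ, E) 𝓘(ℝ, B) ∞ (fun a : G ↦ (a : G ⧸ H)))
  (hι : IsSmoothEmbedding 𝓘(ℝ, F) 𝓘(ℝ, E) ∞ (Subtype.val : H → G))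
  (hD : D.IsLeviCivita g) (hg : g.IsInvariant) (hA : A.IsInvariant)
  (hV : P.IsOrthogonalDecomposition g V)
  (hev : ∀ k, ∀ Z ∈ V k, ∀ u, A.form (basePoint H) u (projDeriv E B H Z)
      = lam k * g.inner (basePoint H) u (projDeriv E B H Z))
include hπ hD hg hA hev

/-- The Codazzi equation in the cyclic form u p = v q. -/
theorem mul_leviCivitaForm_of_isCodazzi (hC : A.IsCodazzi D) {i j k : Fin r}
    {X Y Z : GroupLieAlgebra 𝓘(ℝ, E) G} (hX : X ∈ V i) (hY : Y ∈ V j) (hZ : Z ∈ V k) :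
    (lam j - lam k) * leviCivitaForm g D X Y Z = (lam k - lam i) * leviCivitaForm g D Y Z X := by
  have h : baseCovDeriv A D X Y Z = baseCovDeriv A D Y X Z :=
    (hD.isCodazzi_iff hg hπ hA).1 hC X Y Z
  rw [hD.baseCovDeriv_of_eigen hg hA hev X hY hZ, hD.baseCovDeriv_of_eigen hg hA hev Y hX hZ,
    hD.leviCivitaForm_skew hg Y Z X] at h
  linear_combination h

/-- Of the cyclic relations u p = v q = w s, the factor w is λ_i - λ_i = 0, while u and v are
nonzero. -/
theorem leviCivitaForm_eq_zero (hlam : Function.Injective lam) (hC : A.IsCodazzi D) {i k : Fin r}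
    (hik : k ≠ i) {X Y Z : GroupLieAlgebra 𝓘(ℝ, E) G} (hX : X ∈ V i) (hY : Y ∈ V i) (hZ : Z ∈ V k) :
    leviCivitaForm g D X Y Z = 0 ∧ leviCivitaForm g D Y Z X = 0 := by
  have h1 := mul_leviCivitaForm_of_isCodazzi hπ hD hg hA hev hC hX hY hZ
  have h2 := mul_leviCivitaForm_of_isCodazzi hπ hD hg hA hev hC hY hZ hX
  have h : lam k - lam i ≠ 0 := sub_ne_zero.2 (hlam.ne hik)
  rw [sub_self, zero_mul] at h2
  have h3 := (mul_eq_zero.1 h2).resolve_left h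
  rw [h3, mul_zero] at h1
  exact ⟨(mul_eq_zero.1 h1).resolve_left (sub_ne_zero.2 (hlam.ne hik.symm)), h3⟩

include hι

omit hA hev hD hg [ContMDiffSMul 𝓘(ℝ, E) 𝓘(ℝ, B) ∞ G (G ⧸ H)] in
theorem atBase_bracket (X Y Z : GroupLieAlgebra 𝓘(ℝ, E) G) :
    g.atBase E (P.bracket X Y) Z = g.atBase E ⁅X, Y⁆ Z := by
  unfold SmoothMetric.atBase
  rw [P.projDeriv_bracket hπ hι]

omit hA hev in
-- This turns (∗) into v²(p + q) - w²(s + p) = 0, where p, q, s are the cyclic values of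
-- `leviCivitaForm`.
theorem compatibility_eq (s t : ℝ) (X Y Z : GroupLieAlgebra 𝓘(ℝ, E) G) :
    s * g.atBase E (P.bracket X Y) Z + t * g.atBase E (P.bracket X Z) Y
      = s * (leviCivitaForm g D X Y Z + leviCivitaForm g D Y Z X)
        - t * (leviCivitaForm g D Z X Y + leviCivitaForm g D X Y Z) := by
  have h : g.atBase E ⁅X, Z⁆ Y = -g.atBase E ⁅Z, X⁆ Y := by
    have := lieGroup_minSmoothness E G
    have := FiniteDimensional.complete ℝ E
    rw [← lie_skew X Z]
    simp only [SmoothMetric.atBase, map_neg, neg_apply]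
  rw [atBase_bracket hπ hι, atBase_bracket hπ hι, h, hD.leviCivitaForm_add hg,
    hD.leviCivitaForm_add hg]
  ring

theorem compatible_of_isCodazzi (hC : A.IsCodazzi D) : P.Compatible g V lam := by
  intro i j k X hX Y hY Z hZ
  have h1 := mul_leviCivitaForm_of_isCodazzi hπ hD hg hA hev hC hX hY hZ
  have h2 := mul_leviCivitaForm_of_isCodazzi hπ hD hg hA hev hC hY hZ hX
  rw [compatibility_eq hπ hι hD hg]
  linear_combination (-(lam k - lam i - (lam i - lam j))) * h1 + (lam i - lam j) * h2

include hV

theorem baseCovDeriv_eq_zero_iff :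
    (∀ X Y Z : GroupLieAlgebra 𝓘(ℝ, E) G, baseCovDeriv A D X Y Z = 0) ↔
    ∀ i j k, ∀ X ∈ V i, ∀ Y ∈ V j, ∀ Z ∈ V k,
      (lam j - lam k) * leviCivitaForm g D X Y Z = 0 := by
  constructor
  · intro h i j k X hX Y hY Z hZ
    rw [← hD.baseCovDeriv_of_eigen hg hA hev X hY hZ, h]
  · intro h X Y Z
    obtain ⟨X', hX', hX⟩ := P.exists_mem_compl_projDeriv_eq hπ hι (projDeriv E B H X)
    obtain ⟨Y', hY', hY⟩ := P.exists_mem_compl_projDeriv_eq hπ hι (projDeriv E B H Y)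
    obtain ⟨Z', hZ', hZ⟩ := P.exists_mem_compl_projDeriv_eq hπ hι (projDeriv E B H Z)
    rw [← baseCovDeriv_congr hX hY hZ]
    rw [← hV.iSup_eq] at hX' hY' hZ'
    exact eq_zero_of_mem_iSup baseCovDeriv_add_left (hD.baseCovDeriv_add_middle hA)
      (hD.baseCovDeriv_add_right hA)
      (fun i j k X hX Y hY Z hZ ↦ by
        rw [hD.baseCovDeriv_of_eigen hg hA hev X hY hZ, h i j k X hX Y hY Z hZ]) hX' hY' hZ'

theorem isCodazzi_of_compatible (hC : P.Compatible g V lam) : A.IsCodazzi D := by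
  rw [hD.isCodazzi_iff hg hπ hA]
  intro X Y Z
  change baseCovDeriv A D X Y Z = baseCovDeriv A D Y X Z
  obtain ⟨X', hX', hX⟩ := P.exists_mem_compl_projDeriv_eq hπ hι (projDeriv E B H X)
  obtain ⟨Y', hY', hY⟩ := P.exists_mem_compl_projDeriv_eq hπ hι (projDeriv E B H Y)
  obtain ⟨Z', hZ', hZ⟩ := P.exists_mem_compl_projDeriv_eq hπ hι (projDeriv E B H Z)
  rw [← baseCovDeriv_congr hX hY hZ, ← baseCovDeriv_congr hY hX hZ, ← sub_eq_zero]
  rw [← hV.iSup_eq] at hX' hY' hZ'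
  refine eq_zero_of_mem_iSup (φ := fun X Y Z ↦ baseCovDeriv A D X Y Z - baseCovDeriv A D Y X Z)
    (fun X X' Y Z ↦ ?_) (fun X Y Y' Z ↦ ?_) (fun X Y Z Z' ↦ ?_)
    (fun i j k X hX Y hY Z hZ ↦ ?_) hX' hY' hZ'
  · rw [baseCovDeriv_add_left, hD.baseCovDeriv_add_middle hA]
    ring
  · rw [baseCovDeriv_add_left, hD.baseCovDeriv_add_middle hA]
    ring
  · rw [hD.baseCovDeriv_add_right hA, hD.baseCovDeriv_add_right hA]
    ring
  · have h1 := hC i j k X hX Y hY Z hZ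
    have h2 := hC j k i Y hY Z hZ X hX
    have h3 := hC k i j Z hZ X hX Y hY
    rw [compatibility_eq hπ hι hD hg] at h1 h2 h3
    rw [hD.baseCovDeriv_of_eigen hg hA hev X hY hZ, hD.baseCovDeriv_of_eigen hg hA hev Y hX hZ,
      hD.leviCivitaForm_skew hg Y Z X]
    have h4 := mul_eq_mul_of_sq_relations (p := leviCivitaForm g D X Y Z)
      (q := leviCivitaForm g D Y Z X) (s := leviCivitaForm g D Z X Y)
      (u := lam j - lam k) (v := lam k - lam i) (w := lam i - lam j) (by ring)
      (by linear_combination h1) (by linear_combination h2) (by linear_combination h3)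
    linear_combination h4

theorem not_isParallel_iff (hlam : Function.Injective lam) (hC : A.IsCodazzi D) :
    ¬ A.IsParallel D ↔ P.HasNonzeroTriple g V := by
  rw [hD.isParallel_iff hg hπ hA]
  refine (not_congr (baseCovDeriv_eq_zero_iff hπ hι hD hg hA hV hev)).trans ?_
  -- This is v w (q + s) = w (u p) + v (u p) = -u² p, since v + w = -u.
  have key : ∀ {i j k : Fin r} {X Y Z : GroupLieAlgebra 𝓘(ℝ, E) G}, X ∈ V i → Y ∈ V j → Z ∈ V k →
      (lam k - lam i) * (lam i - lam j) * g.atBase E X (P.bracket Y Z)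
        = -(lam j - lam k) * ((lam j - lam k) * leviCivitaForm g D X Y Z) := by
    intro i j k X Y Z hX hY hZ
    have h1 := mul_leviCivitaForm_of_isCodazzi hπ hD hg hA hev hC hX hY hZ
    have h2 := mul_leviCivitaForm_of_isCodazzi hπ hD hg hA hev hC hY hZ hX
    have h3 : g.atBase E X (P.bracket Y Z) = g.atBase E ⁅Y, Z⁆ X := by
      rw [← atBase_bracket hπ hι (P := P)]
      exact g.symm _ _ _
    rw [h3, ← hD.leviCivitaForm_add hg]
    linear_combination (-(lam i - lam j)) * h1 - (lam k - lam i) * h2 - (lam k - lam i) * h1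
  constructor
  · intro h
    push Not at h
    obtain ⟨i, j, k, X, hX, Y, hY, Z, hZ, h⟩ := h
    have hjk : lam j - lam k ≠ 0 := left_ne_zero_of_mul h
    have h1 := key hX hY hZ
    -- The eigenvalue factors of this product also show i ≠ j and i ≠ k; `hjk` gives j ≠ k.
    have h2 : (lam k - lam i) * (lam i - lam j) * g.atBase E X (P.bracket Y Z) ≠ 0 := by
      rw [h1]
      exact mul_ne_zero (neg_ne_zero.2 hjk) h
    refine ⟨i, j, k, ?_, ?_, ?_, X, hX, Y, hY, Z, hZ, right_ne_zero_of_mul h2⟩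
    · rintro rfl
      simp at h2
    · rintro rfl
      simp at hjk
    · rintro rfl
      simp at h2
  · rintro ⟨i, j, k, hij, hjk, hik, X, hX, Y, hY, Z, hZ, h⟩ h0
    have h1 := key hX hY hZ
    rw [h0 i j k X hX Y hY Z hZ, mul_zero] at h1
    have h2 : lam k - lam i ≠ 0 := sub_ne_zero.2 (hlam.ne hik.symm)
    have h3 : lam i - lam j ≠ 0 := sub_ne_zero.2 (hlam.ne hij)
    exact mul_ne_zero (mul_ne_zero h2 h3) h h1

theorem isSubalgebra_of_isCodazzi (hlam : Function.Injective lam) (hC : A.IsCodazzi D)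
    (i : Fin r) : P.IsSubalgebra (V i) := by
  intro X hX Y hY
  obtain ⟨W, hW, hWe⟩ := hV.exists_projDeriv_eq hπ hι i (projDeriv E B H (P.bracket X Y)) (by
    intro k hk Z hZ
    obtain ⟨h1, h2⟩ := leviCivitaForm_eq_zero hπ hD hg hA hev hlam hC hk hX hY hZ
    have h3 := hD.leviCivitaForm_add hg X Y Z
    rw [h1, h2, ← atBase_bracket hπ hι (P := P), add_zero] at h3
    exact h3.symm)
  have h4 : P.bracket X Y = W := by
    rw [← sub_eq_zero]
    refine P.eq_zero_of_projDeriv_eq_zero hπ hι (P.compl.sub_mem ?_ (hV.le_compl i hW)) ?_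
    · exact Submodule.projection_apply_mem _ _
    · rw [map_sub, hWe, sub_self]
  rwa [h4]

theorem isClosedUnderProduct_of_isCodazzi (hlam : Function.Injective lam) (hC : A.IsCodazzi D)
    (i : Fin r) : P.IsClosedUnderProduct D (V i) := by
  intro X hX Y hY
  -- Vanishing torsion absorbs the bracket in α, leaving ∇_{Y^#} X^#. Its 𝔪_k-components for k ≠ i
  -- vanish by `leviCivitaForm_eq_zero`.
  have h : P.product D X Y
      = D (fun q ↦ fundamentalField B X q) (basePoint H) (projDeriv E B H Y) := by
    have h1 := hD.apply_fundamentalField X Y (basePoint H)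
    simp only [fundamentalField_basePoint] at h1
    have h2 : P.product D X Y
        = D (fun q ↦ fundamentalField B Y q) (basePoint H) (fundamentalField B X (basePoint H))
          + projDeriv E B H (P.bracket X Y) := rfl
    rw [h2, fundamentalField_basePoint, h1, P.projDeriv_bracket hπ hι]
    abel
  rw [h]
  exact hV.exists_projDeriv_eq hπ hι i _ fun k hk Z hZ ↦
    (leviCivitaForm_eq_zero hπ hD hg hA hev hlam hC hk hX hY hZ).1

end ReductiveDecomposition

end Core

/-! ### Smoothness criteria for fields of bilinear forms. -/

section Construction

theorem contDiff_bilinearComp {B B' : Type*} [NormedAddCommGroup B] [NormedSpace ℝ B]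
    [FiniteDimensional ℝ B] [NormedAddCommGroup B'] [NormedSpace ℝ B']
    (β : B' →L[ℝ] B' →L[ℝ] ℝ) :
    ContDiff ℝ ∞ (fun L : B →L[ℝ] B' ↦ β.bilinearComp L L) := by
  rw [contDiff_clm_apply_iff]
  intro u
  rw [contDiff_clm_apply_iff]
  intro v
  change ContDiff ℝ ∞ (fun L : B →L[ℝ] B' ↦ β (L u) (L v))
  fun_prop

variable {B : Type*} [NormedAddCommGroup B] [NormedSpace ℝ B] [FiniteDimensional ℝ B]
  {M : Type*} [TopologicalSpace M] [ChartedSpace B M] [IsManifold 𝓘(ℝ, B) ∞ M]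

/-- Smoothness of a field of bilinear forms which is locally the pullback of a fixed form. -/
theorem contMDiffAt_form_of_eventually_eq {B' : Type*} [NormedAddCommGroup B'] [NormedSpace ℝ B']
    {Ψ : Π p : M, TangentSpace 𝓘(ℝ, B) p →L[ℝ] TangentSpace 𝓘(ℝ, B) p →L[ℝ] ℝ}
    {β : B' →L[ℝ] B' →L[ℝ] ℝ} {L : Π p : M, TangentSpace 𝓘(ℝ, B) p →L[ℝ] B'} {p₀ : M}
    (hL : ContMDiffAt 𝓘(ℝ, B) 𝓘(ℝ, B →L[ℝ] B') ∞
      (fun p ↦ (L p).comp ((trivializationAt B (TangentSpace 𝓘(ℝ, B)) p₀).symmL ℝ p)) p₀)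
    (h : ∀ᶠ p in 𝓝 p₀, ∀ u v, Ψ p u v = β (L p u) (L p v)) :
    ContMDiffAt 𝓘(ℝ, B) (𝓘(ℝ, B).prod 𝓘(ℝ, B →L[ℝ] B →L[ℝ] ℝ)) ∞
      (fun p ↦ TotalSpace.mk' (B →L[ℝ] B →L[ℝ] ℝ)
        (E := fun p : M ↦ TangentSpace 𝓘(ℝ, B) p →L[ℝ] TangentSpace 𝓘(ℝ, B) p →L[ℝ] ℝ) p (Ψ p))
      p₀ := by
  rw [contMDiffAt_hom_bundle]
  refine ⟨contMDiffAt_id,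
    ((contDiff_bilinearComp β).contMDiff.contMDiffAt.comp p₀ hL).congr_of_eventuallyEq ?_⟩
  have hb : ∀ᶠ p in 𝓝 p₀, p ∈ (trivializationAt B (TangentSpace 𝓘(ℝ, B)) p₀).baseSet :=
    (trivializationAt B (TangentSpace 𝓘(ℝ, B)) p₀).open_baseSet.mem_nhds
      (FiberBundle.mem_baseSet_trivializationAt' p₀)
  filter_upwards [h, hb] with p hp hpb
  ext u v
  have h1 := inCoordinates_apply_eq₂ (𝕜 := ℝ) (F₁ := B) (F₂ := B) (F₃ := ℝ)
    (E₁ := fun p : M ↦ TangentSpace 𝓘(ℝ, B) p) (E₂ := fun p : M ↦ TangentSpace 𝓘(ℝ, B) p)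
    (E₃ := Trivial M ℝ) (x₀ := p₀) (x := p) (ϕ := Ψ p) (v := u) (w := v) hpb hpb (mem_univ _)
  refine h1.trans ?_
  simp only [Trivial.fiberBundle_trivializationAt', Trivial.linearMapAt_trivialization,
    LinearMap.id_apply]
  let T : B →L[ℝ] B' := (L p).comp ((trivializationAt B (TangentSpace 𝓘(ℝ, B)) p₀).symmL ℝ p)
  have hT : ∀ u, T u = L p ((trivializationAt B (TangentSpace 𝓘(ℝ, B)) p₀).symm p u) := fun u ↦
    congrArg (L p) (Bundle.Trivialization.symmL_apply (hb := hpb) ..)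
  have h2 := β.bilinearComp_apply T T u v
  rw [hT, hT] at h2
  exact (hp _ _).trans h2.symm

omit [FiniteDimensional ℝ B] in
/-- Smoothness of the derivatives of a family of maps which send the point to a fixed point. -/
theorem contMDiffAt_mfderiv_comp_symmL {M' B' : Type*} [NormedAddCommGroup B'] [NormedSpace ℝ B']
    [TopologicalSpace M'] [ChartedSpace B' M'] [IsManifold 𝓘(ℝ, B') ∞ M'] {f : M → M → M'} {p₀ : M}
    {o : M'} (hf : ContMDiffAt (𝓘(ℝ, B).prod 𝓘(ℝ, B)) 𝓘(ℝ, B') ∞ (Function.uncurry f) (p₀, p₀))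
    (ho : ∀ᶠ p in 𝓝 p₀, f p p = o) :
    ContMDiffAt (M' := B →L[ℝ] B') 𝓘(ℝ, B) 𝓘(ℝ, B →L[ℝ] B') ∞
      (fun p ↦ (mfderiv 𝓘(ℝ, B) 𝓘(ℝ, B') (f p) p : B →L[ℝ] B').comp
        ((trivializationAt B (TangentSpace 𝓘(ℝ, B)) p₀).symmL ℝ p : B →L[ℝ] B)) p₀ := by
  have h1 := ContMDiffAt.mfderiv (m := ∞) f (fun p ↦ p) hf contMDiffAt_id (by simp)
  refine h1.congr_of_eventuallyEq ?_
  have ho' : f p₀ p₀ = o := ho.self_of_nhds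
  filter_upwards [ho, (chartAt B p₀).open_source.mem_nhds (mem_chart_source B p₀)] with p hp hpb
  have h2 := inTangentCoordinates_eq (I := 𝓘(ℝ, B)) (I' := 𝓘(ℝ, B')) (fun p : M ↦ p)
    (fun p ↦ f p p) (fun p ↦ (mfderiv 𝓘(ℝ, B) 𝓘(ℝ, B') (f p) p : B →L[ℝ] B')) (x₀ := p₀) (x := p)
    hpb (by rw [hp, ho']; exact mem_chart_source B' o)
  -- On the source side the coordinate change is `symmL`; on the target side it is the identity,
  -- because f p p stays at o.
  refine Eq.trans ?_ h2.symm
  rw [hp, ho']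
  rw [TangentBundle.symmL_trivializationAt_eq_core hpb]
  ext v
  exact ((tangentBundleCore 𝓘(ℝ, B') M').coordChange_self (achart B' o) o
    (mem_chart_source B' o) _).symm

end Construction

/-! ### Extending an invariant form from eH to G/H. -/

section InvariantExtension

variable {E : Type*} [NormedAddCommGroup E] [NormedSpace ℝ E]
  {B : Type*} [NormedAddCommGroup B] [NormedSpace ℝ B]
  {G : Type*} [Group G] [TopologicalSpace G] [ChartedSpace E G]
  {H : Subgroup G} [ChartedSpace B (G ⧸ H)]

theorem mk_out_inv_smul (p : G ⧸ H) : (Quotient.out p)⁻¹ • p = basePoint H := by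
  have h : ((Quotient.out p : G) : G ⧸ H) = p := Quotient.out_eq p
  have h2 : (Quotient.out p)⁻¹ • ((Quotient.out p : G) : G ⧸ H) = basePoint H :=
    congrArg QuotientGroup.mk (inv_mul_cancel _)
  rwa [h] at h2

/-- The pullback of a form on the tangent space at the base point by a translation. -/
def translationPullback (β : B →L[ℝ] B →L[ℝ] ℝ) (a : G) (p : G ⧸ H) : B →L[ℝ] B →L[ℝ] ℝ :=
  β.bilinearComp (translationDeriv B H a p : B →L[ℝ] B) (translationDeriv B H a p : B →L[ℝ] B)

theorem translationPullback_mul (hs : ContMDiffSMul 𝓘(ℝ, E) 𝓘(ℝ, B) ∞ G (G ⧸ H))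
    (β : B →L[ℝ] B →L[ℝ] ℝ) (a b : G) (p : G ⧸ H) (u v : B) :
    translationPullback β (a * b) p u v
      = translationPullback β a (b • p) (translationDeriv B H b p u : B)
        (translationDeriv B H b p v : B) :=
  congrArg₂ (fun u v : B ↦ β u v) (translationDeriv_mul hs a b p u)
    (translationDeriv_mul hs a b p v)

/-- The element b a⁻¹ fixes eH, so it lies in H and preserves β. Hence the pullback does not depend
on which element moves p to eH. -/
theorem translationPullback_eq (hs : ContMDiffSMul 𝓘(ℝ, E) 𝓘(ℝ, B) ∞ G (G ⧸ H))
    {β : B →L[ℝ] B →L[ℝ] ℝ}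
    (hβ : ∀ h ∈ H, ∀ u v : B, translationPullback β h (basePoint H) u v = β u v) {a b : G}
    {p : G ⧸ H} (ha : a • p = basePoint H) (hb : b • p = basePoint H) (u v : B) :
    translationPullback β a p u v = translationPullback β b p u v := by
  have hh : b * a⁻¹ ∈ H := by
    have h1 : (b * a⁻¹) • basePoint H = basePoint H := by
      rw [mul_smul, ← ha, inv_smul_smul, hb, ha]
    have h2 : (((b * a⁻¹) * 1 : G) : G ⧸ H) = ((1 : G) : G ⧸ H) := h1
    rw [mul_one, eq_comm, QuotientGroup.eq] at h2
    simpa using h2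
  have h3 := translationPullback_mul hs β (b * a⁻¹) a p u v
  rw [inv_mul_cancel_right, ha] at h3
  exact (h3.trans (hβ _ hh _ _)).symm

variable [FiniteDimensional ℝ B] [IsManifold 𝓘(ℝ, B) ∞ (G ⧸ H)] [LieGroup 𝓘(ℝ, E) ∞ G]

/-- The invariant tensor field with a given value at the base point. -/
def invariantTensor (hs : ContMDiffSMul 𝓘(ℝ, E) 𝓘(ℝ, B) ∞ G (G ⧸ H))
    (hπ : IsSubmersion 𝓘(ℝ, E) 𝓘(ℝ, B) ∞ (fun a : G ↦ (a : G ⧸ H)))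
    (β : B →L[ℝ] B →L[ℝ] ℝ) (hsymm : ∀ u v, β u v = β v u)
    (hβ : ∀ h ∈ H, ∀ u v : B, translationPullback β h (basePoint H) u v = β u v) :
    SymmTensorField B (G ⧸ H) where
  form p := (translationPullback β (Quotient.out p)⁻¹ p : B →L[ℝ] B →L[ℝ] ℝ)
  symm p u v := hsymm (translationDeriv B H (Quotient.out p)⁻¹ p u : B)
    (translationDeriv B H (Quotient.out p)⁻¹ p v : B)
  contMDiff p := by
    obtain ⟨b, rfl⟩ := QuotientGroup.mk_surjective p
    -- The representatives `Quotient.out` need not vary continuously. Near the point they may be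
    -- replaced by the smooth s without changing the form.
    obtain ⟨s, hs1, -, hfs⟩ := (hπ.isSubmersionAt b).exists_local_section
    have ho : ∀ᶠ q in 𝓝 (b : G ⧸ H), (s q)⁻¹ • q = basePoint H := by
      filter_upwards [hfs] with q hq
      have h2 : (s q)⁻¹ • ((s q : G) : G ⧸ H) = basePoint H :=
        congrArg QuotientGroup.mk (inv_mul_cancel _)
      rwa [hq] at h2
    refine contMDiffAt_form_of_eventually_eq (B' := B) (β := β)
      (L := fun q ↦ (translationDeriv B H (s q)⁻¹ q : B →L[ℝ] B)) ?_ ?_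
    · refine contMDiffAt_mfderiv_comp_symmL (M' := G ⧸ H) (f := fun q q' ↦ (s q)⁻¹ • q') ?_ ho
      have h1 : ContMDiffAt (𝓘(ℝ, B).prod 𝓘(ℝ, B)) 𝓘(ℝ, E) ∞
          (fun x : (G ⧸ H) × (G ⧸ H) ↦ (s x.1)⁻¹) ((b : G ⧸ H), (b : G ⧸ H)) :=
        (hs1.comp ((b : G ⧸ H), (b : G ⧸ H)) contMDiffAt_fst).inv
      exact h1.smul contMDiffAt_snd
    · filter_upwards [ho] with q hq u v
      exact translationPullback_eq hs hβ (mk_out_inv_smul q) hq u v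

variable (hs : ContMDiffSMul 𝓘(ℝ, E) 𝓘(ℝ, B) ∞ G (G ⧸ H))
    (hπ : IsSubmersion 𝓘(ℝ, E) 𝓘(ℝ, B) ∞ (fun a : G ↦ (a : G ⧸ H)))
    {β : B →L[ℝ] B →L[ℝ] ℝ} (hsymm : ∀ u v, β u v = β v u)
    (hβ : ∀ h ∈ H, ∀ u v : B, translationPullback β h (basePoint H) u v = β u v)

theorem invariantTensor_isInvariant : (invariantTensor hs hπ β hsymm hβ).IsInvariant := by
  intro a p u v
  refine (translationPullback_mul hs β (Quotient.out (a • p))⁻¹ a p u v).symm.trans ?_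
  refine translationPullback_eq hs hβ ?_ (mk_out_inv_smul p) u v
  rw [mul_smul, mk_out_inv_smul]

theorem invariantTensor_form_basePoint (u v : B) :
    (invariantTensor hs hπ β hsymm hβ).form (basePoint H) u v = β u v := by
  refine (translationPullback_eq hs hβ (mk_out_inv_smul _) (one_smul G _) u v).trans ?_
  exact hβ 1 H.one_mem u v

omit [LieGroup 𝓘(ℝ, E) ∞ G] in
include hs in
theorem SymmTensorField.IsInvariant.eq_of_form_basePoint_eq {A A' : SymmTensorField B (G ⧸ H)}
    (hA : A.IsInvariant) (hA' : A'.IsInvariant)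
    (h : ∀ u v, A.form (basePoint H) u v = A'.form (basePoint H) u v) : A = A' := by
  have h1 : A.form = A'.form := by
    funext p
    obtain ⟨a, rfl⟩ := QuotientGroup.mk_surjective p
    have ha : (a : G ⧸ H) = a • basePoint H := congrArg QuotientGroup.mk (mul_one a).symm
    rw [ha]
    refine ContinuousLinearMap.ext fun u ↦ ContinuousLinearMap.ext fun v ↦ ?_
    obtain ⟨u, rfl⟩ := translationDeriv_surjective hs a (basePoint H) u
    obtain ⟨v, rfl⟩ := translationDeriv_surjective hs a (basePoint H) v
    rw [hA, hA', h]
  cases A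
  cases A'
  cases h1
  rfl

end InvariantExtension

/-! ### Linear algebra of orthogonal and independent subspaces. -/

section Orthogonality

variable {W : Type*} [AddCommGroup W] [Module ℝ W] {ι : Type*} {V : ι → Submodule ℝ W}

theorem iSupIndep_of_orthogonal (γ : LinearMap.BilinForm ℝ W)
    (hpos : ∀ i, ∀ x ∈ V i, γ x x = 0 → x = 0)
    (horth : ∀ i j, i ≠ j → ∀ x ∈ V i, ∀ y ∈ V j, γ x y = 0) : iSupIndep V := by
  intro i
  rw [Submodule.disjoint_def]
  intro x hx hx'
  have h : ⨆ j, ⨆ _ : j ≠ i, V j ≤ LinearMap.ker (γ x) :=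
    iSup₂_le fun j hj y hy ↦ horth i j hj.symm x hx y hy
  exact hpos i x hx (h hx')

theorem exists_end_eq_smul (hV : iSupIndep V) (c : ι → ℝ) :
    ∃ K : Module.End ℝ W, ∀ i, ∀ x ∈ V i, K x = c i • x := by
  classical
  -- Independence embeds the external direct sum in W. A left inverse L splits vectors of the sum
  -- into components, which are then scaled by c.
  obtain ⟨L, hL⟩ := LinearMap.exists_leftInverse_of_injective
    (DirectSum.coeLinearMap V) (LinearMap.ker_eq_bot.2 hV.dfinsupp_lsum_injective)
  refine ⟨DirectSum.toModule ℝ ι W (fun i ↦ c i • (V i).subtype) ∘ₗ L, fun i x hx ↦ ?_⟩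
  have h := LinearMap.congr_fun hL (DirectSum.lof ℝ ι (fun i ↦ V i) i ⟨x, hx⟩)
  simp only [LinearMap.comp_apply, DirectSum.coeLinearMap_lof, LinearMap.id_apply] at h
  simp only [LinearMap.comp_apply]
  rw [h, DirectSum.toModule_lof]
  rfl

/-- Two bilinear forms which agree on a spanning family of subspaces are equal. -/
theorem bilinear_ext_of_iSup_eq_top {φ ψ : LinearMap.BilinForm ℝ W} (hV : ⨆ i, V i = ⊤)
    (h : ∀ i j, ∀ x ∈ V i, ∀ y ∈ V j, φ x y = ψ x y) : φ = ψ := by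
  have h1 : ∀ i, ∀ x ∈ V i, φ x = ψ x := by
    intro i x hx
    have h2 : ⨆ j, V j ≤ LinearMap.eqLocus (φ x) (ψ x) := iSup_le fun j y hy ↦ h i j x hx y hy
    rw [hV] at h2
    exact LinearMap.ext fun y ↦ h2 trivial
  have h3 : ⨆ i, V i ≤ LinearMap.eqLocus φ ψ := iSup_le h1
  rw [hV] at h3
  exact LinearMap.ext fun x ↦ h3 trivial

end Orthogonality

/-! ### Eigenspaces of an invariant tensor field and the tensor field of a decomposition. -/

section Eigenspaces

variable {E : Type*} [NormedAddCommGroup E] [NormedSpace ℝ E] [FiniteDimensional ℝ E]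
  {F : Type*} [NormedAddCommGroup F] [NormedSpace ℝ F]
  {B : Type*} [NormedAddCommGroup B] [NormedSpace ℝ B] [FiniteDimensional ℝ B]
  {G : Type*} [Group G] [TopologicalSpace G] [ChartedSpace E G] [LieGroup 𝓘(ℝ, E) ∞ G]
  {H : Subgroup G} [ChartedSpace F H] [LieGroup 𝓘(ℝ, F) ∞ H]
  [ChartedSpace B (G ⧸ H)] [IsManifold 𝓘(ℝ, B) ∞ (G ⧸ H)]
  {P : ReductiveDecomposition E F H}
  {g : SmoothMetric B (G ⧸ H)} {A : SymmTensorField B (G ⧸ H)}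

variable (E A) in
/-- The form of a tensor field at the base point, as a bilinear form on the Lie algebra. -/
def SymmTensorField.atBaseForm : LinearMap.BilinForm ℝ (GroupLieAlgebra 𝓘(ℝ, E) G) :=
  LinearMap.mk₂ ℝ (A.atBase E)
    (fun X X' Y ↦ by simp only [SymmTensorField.atBase, map_add, add_apply])
    (fun c X Y ↦ by simp only [SymmTensorField.atBase, map_smul, smul_apply])
    (fun X Y Y' ↦ by simp only [SymmTensorField.atBase, map_add])
    (fun c X Y ↦ by simp only [SymmTensorField.atBase, map_smul])

theorem SmoothMetric.eq_zero_of_atBase_self {X : GroupLieAlgebra 𝓘(ℝ, E) G}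
    (h : g.atBase E X X = 0) : projDeriv E B H X = 0 := by
  by_contra hne
  exact (g.pos _ _ hne).ne' h

namespace ReductiveDecomposition

/-- Both A and g are Ad(H)-invariant at eH, so Ad(h) moves to the other argument as Ad(h⁻¹), which
preserves 𝔪. -/
theorem adInvariant_eigenspace [ContMDiffSMul 𝓘(ℝ, E) 𝓘(ℝ, B) ∞ G (G ⧸ H)] (hg : g.IsInvariant)
    (hA : A.IsInvariant) (c : ℝ) : P.AdInvariant (P.eigenspace g A c) := by
  intro h hh X hX
  refine ⟨P.ad_mem h hh X hX.1, fun Y hY ↦ ?_⟩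
  have hY' := P.ad_mem h⁻¹ (H.inv_mem hh) Y hY
  have h1 := hA.atBase_adjointAction hh X (adjointAction E h⁻¹ Y)
  have h2 := SymmTensorField.IsInvariant.atBase_adjointAction (A := g.toTensor) hg hh X
    (adjointAction E h⁻¹ Y)
  rw [adjointAction_apply_inv] at h1 h2
  rw [h1]
  refine (hX.2 _ hY').trans ?_
  exact congrArg (c * ·) h2.symm

variable (hπ : IsSubmersion 𝓘(ℝ, E) 𝓘(ℝ, B) ∞ (fun a : G ↦ (a : G ⧸ H)))
  (hι : IsSmoothEmbedding 𝓘(ℝ, F) 𝓘(ℝ, E) ∞ (Subtype.val : H → G))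
include hπ hι

/-- Since dπ maps 𝔪 onto the tangent space, the eigenvalue equation can be tested on all u, the form
used in the algebraic part. -/
theorem form_eq_of_mem_eigenspace {c : ℝ} {Z : GroupLieAlgebra 𝓘(ℝ, E) G}
    (hZ : Z ∈ P.eigenspace g A c) (u : TangentSpace 𝓘(ℝ, B) (basePoint H)) :
    A.form (basePoint H) u (projDeriv E B H Z)
      = c * g.inner (basePoint H) u (projDeriv E B H Z) := by
  obtain ⟨Y, hY, rfl⟩ := P.exists_mem_compl_projDeriv_eq hπ hι u
  rw [A.symm, g.symm]
  exact hZ.2 Y hY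

theorem atBase_eq_zero_of_mem_eigenspace {c d : ℝ} (hcd : c ≠ d) {X Y : GroupLieAlgebra 𝓘(ℝ, E) G}
    (hX : X ∈ P.eigenspace g A c) (hY : Y ∈ P.eigenspace g A d) : g.atBase E X Y = 0 := by
  have h1 := hX.2 Y hY.1
  have h2 : A.atBase E X Y = d * g.atBase E X Y := form_eq_of_mem_eigenspace hπ hι hY _
  have h3 : (c - d) * g.atBase E X Y = 0 := by linear_combination h2 - h1
  exact (mul_eq_zero.1 h3).resolve_left (sub_ne_zero.2 hcd)

variable (P g A) in
theorem exists_eigenspace_decomposition :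
    ∃ (r : ℕ) (lam : Fin r → ℝ), StrictMono lam ∧
      (∀ c : ℝ, P.eigenspace g A c ≠ ⊥ ↔ c ∈ Set.range lam) ∧
      P.IsOrthogonalDecomposition g (fun i ↦ P.eigenspace g A (lam i)) := by
  have : FiniteDimensional ℝ (GroupLieAlgebra 𝓘(ℝ, E) G) := inferInstanceAs (FiniteDimensional ℝ E)
  let ι := P.compl.subtype
  -- On 𝔪 the form of g is positive definite, because dπ is injective there.
  obtain ⟨T, hT, htop⟩ := exists_mem_iSup_eigenspace ((A.atBaseForm E).compl₁₂ ι ι)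
    ((g.toTensor.atBaseForm E).compl₁₂ ι ι) (fun x y ↦ A.symm _ _ _) (fun x y ↦ g.symm _ _ _)
    (fun x hx ↦ by
      refine g.pos _ _ fun h ↦ hx ?_
      exact Subtype.ext (P.eq_zero_of_projDeriv_eq_zero hπ hι x.2 h))
  have hTe : ∀ x y : P.compl, g.atBase E (T x) y = A.atBase E x y := hT
  have hmap : ∀ c, (T.eigenspace c).map ι = P.eigenspace g A c := by
    intro c
    ext X
    constructor
    · rintro ⟨x, hx, rfl⟩
      refine ⟨x.2, fun Y hY ↦ ?_⟩
      have h1 := hTe x ⟨Y, hY⟩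
      rw [Module.End.mem_eigenspace_iff.1 hx] at h1
      refine h1.symm.trans ?_
      exact LinearMap.map_smul₂ (g.toTensor.atBaseForm E) c (x : GroupLieAlgebra 𝓘(ℝ, E) G) Y
    · intro hX
      refine ⟨⟨X, hX.1⟩, Module.End.mem_eigenspace_iff.2 (sub_eq_zero.1 ?_), rfl⟩
      have h0 : ∀ y : P.compl, g.atBase E (T ⟨X, hX.1⟩ - c • ⟨X, hX.1⟩ : P.compl) y = 0 := by
        intro y
        have h1 := LinearMap.map_sub₂ (g.toTensor.atBaseForm E)
          (T ⟨X, hX.1⟩ : GroupLieAlgebra 𝓘(ℝ, E) G) (c • X) y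
        have h2 := LinearMap.map_smul₂ (g.toTensor.atBaseForm E) c X y
        rw [h2] at h1
        refine h1.trans (sub_eq_zero.2 ?_)
        exact (hTe _ _).trans (hX.2 y y.2)
      have h3 := SmoothMetric.eq_zero_of_atBase_self (h0 (T ⟨X, hX.1⟩ - c • ⟨X, hX.1⟩))
      exact Subtype.ext (P.eq_zero_of_projDeriv_eq_zero hπ hι (Subtype.prop _) h3)
  have hne : ∀ c, P.eigenspace g A c ≠ ⊥ ↔ T.HasEigenvalue c := by
    intro c
    rw [← hmap, (Submodule.map_injective_of_injective P.compl.injective_subtype).ne_iff'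
      (Submodule.map_bot ι)]
    exact Iff.rfl
  have hfin : Set.Finite {c | T.HasEigenvalue c} := Module.End.finite_hasEigenvalue T
  -- The increasing enumeration of the finitely many eigenvalues; it is empty when 𝔪 = 0.
  let lam := hfin.toFinset.orderEmbOfFin rfl
  have hrange : ∀ c : ℝ, P.eigenspace g A c ≠ ⊥ ↔ c ∈ Set.range lam := by
    intro c
    rw [hne, Finset.range_orderEmbOfFin]
    simp
  refine ⟨_, lam, lam.strictMono, hrange, ?_, ?_, ?_⟩
  · refine iSupIndep_of_orthogonal (g.toTensor.atBaseForm E) (fun i X hX h ↦ ?_)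
      (fun i j hij X hX Y hY ↦
        atBase_eq_zero_of_mem_eigenspace hπ hι (lam.injective.ne hij) hX hY)
    exact P.eq_zero_of_projDeriv_eq_zero hπ hι hX.1 (SmoothMetric.eq_zero_of_atBase_self h)
  · refine le_antisymm (iSup_le fun i X hX ↦ hX.1) ?_
    have h1 : ⨆ c, P.eigenspace g A c = P.compl := by
      simp_rw [← hmap]
      rw [← Submodule.map_iSup, htop, Submodule.map_top, Submodule.range_subtype]
    refine h1.ge.trans (iSup_le fun c ↦ ?_)
    by_cases hc : P.eigenspace g A c = ⊥
    · rw [hc]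
      exact bot_le
    · obtain ⟨i, rfl⟩ := (hrange c).1 hc
      exact le_iSup (fun i ↦ P.eigenspace g A (lam i)) i
  · exact fun i j hij X hX Y hY ↦
      atBase_eq_zero_of_mem_eigenspace hπ hι (lam.injective.ne hij) hX hY

omit hπ hι [LieGroup 𝓘(ℝ, E) ∞ G] [FiniteDimensional ℝ E] [LieGroup 𝓘(ℝ, F) ∞ H] in
theorem HasNonzeroTriple.three_le {r : ℕ} {V : Fin r → Submodule ℝ (GroupLieAlgebra 𝓘(ℝ, E) G)}
    (h : P.HasNonzeroTriple g V) : 3 ≤ r := by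
  obtain ⟨i, j, k, hij, hjk, hik, -⟩ := h
  have := i.2
  have := j.2
  have := k.2
  have := Fin.val_ne_of_ne hij
  have := Fin.val_ne_of_ne hjk
  have := Fin.val_ne_of_ne hik
  omega

end ReductiveDecomposition

section Extension

variable {r : ℕ} {V : Fin r → Submodule ℝ (GroupLieAlgebra 𝓘(ℝ, E) G)} {lam : Fin r → ℝ}
  (hs : ContMDiffSMul 𝓘(ℝ, E) 𝓘(ℝ, B) ∞ G (G ⧸ H))
  (hπ : IsSubmersion 𝓘(ℝ, E) 𝓘(ℝ, B) ∞ (fun a : G ↦ (a : G ⧸ H)))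
  (hι : IsSmoothEmbedding 𝓘(ℝ, F) 𝓘(ℝ, E) ∞ (Subtype.val : H → G))
  (hV : P.IsOrthogonalDecomposition g V)
include hπ hι hV

/-- The images of the summands span the tangent space at the base point. -/
theorem ReductiveDecomposition.IsOrthogonalDecomposition.iSup_map_projDeriv :
    ⨆ i, (V i).map (projDeriv E B H : E →L[ℝ] B).toLinearMap = ⊤ := by
  rw [← Submodule.map_iSup, hV.iSup_eq, eq_top_iff]
  intro u _
  exact P.exists_mem_compl_projDeriv_eq hπ hι u

theorem ReductiveDecomposition.IsOrthogonalDecomposition.bilinear_ext {φ ψ : B →L[ℝ] B →L[ℝ] ℝ}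
    (h : ∀ i j, ∀ X ∈ V i, ∀ Y ∈ V j, φ (projDeriv E B H X : B) (projDeriv E B H Y : B)
      = ψ (projDeriv E B H X : B) (projDeriv E B H Y : B)) (u v : B) : φ u v = ψ u v := by
  have h1 := bilinear_ext_of_iSup_eq_top (φ := φ.toLinearMap₁₂) (ψ := ψ.toLinearMap₁₂)
    (hV.iSup_map_projDeriv hπ hι) (by
      rintro i j _ ⟨X, hX, rfl⟩ _ ⟨Y, hY, rfl⟩
      exact h i j X hX Y hY)
  exact LinearMap.congr_fun₂ h1 u v

include hs in
theorem SymmTensorField.IsInvariant.eq_of_atBase_eq {A A' : SymmTensorField B (G ⧸ H)}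
    (hA : A.IsInvariant) (hA' : A'.IsInvariant)
    (h : ∀ i j, ∀ X ∈ V i, ∀ Y ∈ V j, A.atBase E X Y = A'.atBase E X Y) : A = A' :=
  hA.eq_of_form_basePoint_eq hs hA' (hV.bilinear_ext hπ hι h)

include hs in
/-- The invariant tensor field with prescribed eigenspaces and eigenvalues. -/
theorem ReductiveDecomposition.IsOrthogonalDecomposition.exists_isInvariant (hg : g.IsInvariant)
    (hAd : ∀ i, P.AdInvariant (V i)) (lam : Fin r → ℝ) :
    ∃ A : SymmTensorField B (G ⧸ H), A.IsInvariant ∧ ∀ k, ∀ Z ∈ V k, ∀ u,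
      A.form (basePoint H) u (projDeriv E B H Z)
        = lam k * g.inner (basePoint H) u (projDeriv E B H Z) := by
  let pr : E →L[ℝ] B := projDeriv E B H
  let γ : B →L[ℝ] B →L[ℝ] ℝ := g.inner (basePoint H)
  have hγ : ∀ u v, γ u v = γ v u := g.symm (basePoint H)
  have hind : iSupIndep fun i ↦ (V i).map pr.toLinearMap :=
    iSupIndep_of_orthogonal γ.toLinearMap₁₂
      (fun i u _ h ↦ by
        by_contra hne
        exact (g.pos (basePoint H) u hne).ne' h)
      (by
        rintro i j hij _ ⟨X, hX, rfl⟩ _ ⟨Y, hY, rfl⟩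
        exact hV.orthogonal i j hij X hX Y hY)
  obtain ⟨K, hK⟩ := exists_end_eq_smul hind lam
  -- K multiplies the i-th summand by λ_i. Symmetry of β uses orthogonality of the summands, and
  -- H-invariance uses their Ad(H)-invariance.
  let β : B →L[ℝ] B →L[ℝ] ℝ := γ.comp (LinearMap.toContinuousLinearMap K)
  have hβ : ∀ i, ∀ X ∈ V i, ∀ v, β (pr X) v = lam i * γ (pr X) v := by
    intro i X hX v
    have h1 : K (pr X) = lam i • pr X := hK i _ (Submodule.mem_map_of_mem hX)
    change γ (K (pr X)) v = _
    rw [h1, map_smul]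
    rfl
  have hsymm : ∀ u v, β u v = β v u := by
    refine hV.bilinear_ext hπ hι (ψ := β.flip) fun i j X hX Y hY ↦ ?_
    change β (pr X) (pr Y) = β (pr Y) (pr X)
    rw [hβ i X hX, hβ j Y hY, hγ (pr Y)]
    by_cases hij : i = j
    · rw [hij]
    · have h1 : γ (pr X) (pr Y) = 0 := hV.orthogonal i j hij X hX Y hY
      rw [h1, mul_zero, mul_zero]
  have hinv : ∀ h ∈ H, ∀ u v : B, translationPullback β h (basePoint H) u v = β u v := by
    intro h hh
    refine hV.bilinear_ext hπ hι fun i j X hX Y hY ↦ ?_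
    have h1 := SymmTensorField.IsInvariant.atBase_adjointAction (A := g.toTensor) hg hh X Y
    have h2 := hβ i _ (hAd i h hh X hX) (pr (adjointAction E h Y))
    refine Eq.trans ?_ ((h2.trans (congrArg (lam i * ·) h1)).trans (hβ i X hX (pr Y)).symm)
    exact (congrArg₂ (fun u v : B ↦ β u v) (projDeriv_adjointAction B H hh X)
      (projDeriv_adjointAction B H hh Y)).symm
  refine ⟨invariantTensor hs hπ β hsymm hinv, invariantTensor_isInvariant hs hπ hsymm hinv,
    fun k Z hZ u ↦ ?_⟩
  refine (invariantTensor_form_basePoint hs hπ hsymm hinv u (pr Z)).trans ?_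
  exact ((hsymm u (pr Z)).trans (hβ k Z hZ u)).trans (congrArg (lam k * ·) (hγ (pr Z) u))

end Extension

end Eigenspaces

/-! ### The theorem, in both directions. -/

theorem proposition2p1
    {E : Type*} [NormedAddCommGroup E] [NormedSpace ℝ E] [FiniteDimensional ℝ E]
    {F : Type*} [NormedAddCommGroup F] [NormedSpace ℝ F] [FiniteDimensional ℝ F]
    {B : Type*} [NormedAddCommGroup B] [NormedSpace ℝ B] [FiniteDimensional ℝ B]
    -- `G` is a Lie group and `H` is a closed Lie subgroup
    {G : Type*} [Group G] [TopologicalSpace G] [T2Space G] [ChartedSpace E G]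
    [LieGroup 𝓘(ℝ, E) ∞ G]
    (H : Subgroup G) [ChartedSpace F H] [LieGroup 𝓘(ℝ, F) ∞ H]
    (hH : IsClosed (H : Set G))
    (hι : IsSmoothEmbedding 𝓘(ℝ, F) 𝓘(ℝ, E) ∞ (Subtype.val : H → G))
    -- `G/H` carries its smooth structure, the one for which the projection is a submersion
    [ChartedSpace B (G ⧸ H)] [IsManifold 𝓘(ℝ, B) ∞ (G ⧸ H)]
    (hπ : IsSubmersion 𝓘(ℝ, E) 𝓘(ℝ, B) ∞ (fun a : G ↦ (a : G ⧸ H)))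
    -- a reductive decomposition, an invariant Riemannian metric, its Levi-Civita connection
    (P : ReductiveDecomposition E F H)
    (g : SmoothMetric B (G ⧸ H)) (hg : g.IsInvariant)
    (D : AffineConnection B (G ⧸ H)) (hD : D.IsLeviCivita g) :
    -- the eigenspaces of an invariant Codazzi tensor field
    (∀ A : SymmTensorField B (G ⧸ H), A.IsInvariant → A.IsCodazzi D →
      ∃ (r : ℕ) (lam : Fin r → ℝ), StrictMono lam ∧
        (∀ c : ℝ, P.eigenspace g A c ≠ ⊥ ↔ c ∈ Set.range lam) ∧
        P.IsOrthogonalDecomposition g (fun i ↦ P.eigenspace g A (lam i)) ∧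
        (∀ i, P.AdInvariant (P.eigenspace g A (lam i)) ∧
          P.IsSubalgebra (P.eigenspace g A (lam i)) ∧
          P.IsClosedUnderProduct D (P.eigenspace g A (lam i))) ∧
        P.Compatible g (fun i ↦ P.eigenspace g A (lam i)) lam ∧
        (¬ A.IsParallel D ↔ P.HasNonzeroTriple g (fun i ↦ P.eigenspace g A (lam i))) ∧
        (¬ A.IsParallel D → 3 ≤ r)) ∧
    -- the invariant Codazzi tensor field defined by a decomposition
    (∀ (r : ℕ) (V : Fin r → Submodule ℝ (GroupLieAlgebra 𝓘(ℝ, E) G)) (lam : Fin r → ℝ),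
      P.IsOrthogonalDecomposition g V → (∀ i, P.AdInvariant (V i)) →
      Function.Injective lam → P.Compatible g V lam →
      ∃ A : SymmTensorField B (G ⧸ H), A.IsInvariant ∧
        (∀ i j, ∀ X ∈ V i, ∀ Y ∈ V j,
          A.atBase E X Y = if i = j then lam i * g.atBase E X Y else 0) ∧
        A.IsCodazzi D ∧
        (¬ A.IsParallel D ↔ P.HasNonzeroTriple g V) ∧
        (∀ A' : SymmTensorField B (G ⧸ H), A'.IsInvariant →
          (∀ i j, ∀ X ∈ V i, ∀ Y ∈ V j,
            A'.atBase E X Y = if i = j then lam i * g.atBase E X Y else 0) →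
          A' = A)) := by
  have hs := contMDiffSMul_quotient (E := E) hπ
  refine ⟨fun A hA hC ↦ ?_, fun r V lam hV hAd hlam hcomp ↦ ?_⟩
  · obtain ⟨r, lam, hlam, hrange, hV⟩ := P.exists_eigenspace_decomposition g A hπ hι
    have hev : ∀ k, ∀ Z ∈ P.eigenspace g A (lam k), ∀ u,
        A.form (basePoint H) u (projDeriv E B H Z)
          = lam k * g.inner (basePoint H) u (projDeriv E B H Z) :=
      fun k Z hZ u ↦ ReductiveDecomposition.form_eq_of_mem_eigenspace hπ hι hZ u
    have hpar := ReductiveDecomposition.not_isParallel_iff hπ hι hD hg hA hV hev hlam.injective hC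
    exact ⟨r, lam, hlam, hrange, hV, fun i ↦
      ⟨ReductiveDecomposition.adInvariant_eigenspace hg hA (lam i),
        ReductiveDecomposition.isSubalgebra_of_isCodazzi hπ hι hD hg hA hV hev hlam.injective hC i,
        ReductiveDecomposition.isClosedUnderProduct_of_isCodazzi hπ hι hD hg hA hV hev
          hlam.injective hC i⟩,
      ReductiveDecomposition.compatible_of_isCodazzi hπ hι hD hg hA hev hC, hpar,
      fun h ↦ (hpar.1 h).three_le⟩
  · obtain ⟨A, hA, hev⟩ := hV.exists_isInvariant hs hπ hι hg hAd lam
    have hC := ReductiveDecomposition.isCodazzi_of_compatible hπ hι hD hg hA hV hev hcomp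
    have hval : ∀ i j, ∀ X ∈ V i, ∀ Y ∈ V j,
        A.atBase E X Y = if i = j then lam i * g.atBase E X Y else 0 := by
      intro i j X hX Y hY
      have h1 : A.atBase E X Y = lam j * g.atBase E X Y := hev j Y hY _
      split_ifs with hij
      · rw [h1, hij]
      · rw [h1, hV.orthogonal i j hij X hX Y hY, mul_zero]
    refine ⟨A, hA, hval, hC,
      ReductiveDecomposition.not_isParallel_iff hπ hι hD hg hA hV hev hlam hC,
      fun A' hA' hval' ↦ hA'.eq_of_atBase_eq hs hπ hι hV hA fun i j X hX Y hY ↦ ?_⟩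
    rw [hval i j X hX Y hY, hval' i j X hX Y hY]
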